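/- **Setting.** Let $\|\cdot\|$ be any norm on $\mathbb R^d$ with dual norm $\|\cdot\|_*$, let $\mathcal X\subset\mathbb R^d$ be compact and convex, let $\Xi$ be a standard Borel sample space with a probability distribution $\Pi$, and let $F(\cdot;\xi)$, $\xi\in\Xi$, be convex functions on $\mathcal X$ (jointly measurable, $\Pi$-integrable in $\xi$), $f(x)=\mathbb E_\Pi[F(x;\xi)]$. Let $\mathsf G(x;\xi)$ be a measurable selection of subgradients of $F(\cdot;\xi)$ at $x\in\mathcal X$. Let $\psi$ be differentiable on $\mathcal X$ and $1$-strongly convex over $\mathcal X$, i.e. $\psi(y)\ge\psi(x)+\langle\nabla\psi(x),y-x\rangle+\frac12\|x-y\|^2$ for $x,y\in\mathcal X$, let $D_\psi(x,y)=\psi(x)-\psi(y)-\langle\nabla\psi(y),x-y\rangle$, and let $R\ge 0$ satisfy $D_\psi(x,y)\le\frac12R^2$ for all $x,y\in\mathcal X$. Let $\xi_1,\xi_2,\dots$ be a stochastic process in $\Xi$ with law $P$ (no stationarity or Markov property is assumed), $\mathcal F_s=\sigma(\xi_1,\dots,\xi_s)$ for $s\ge 0$, and $P_{[s]}^t$ the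 conditional distribution of $\xi_t$ given $\mathcal F_s$. Given nonincreasing positive stepsizes $\alpha(t)$ and an arbitrary $x(1)\in\mathcal X$, the ergodic mirror descent iterates are $$x(t+1)=\operatorname*{argmin}_{x\in\mathcal X}\Big\{\langle \mathsf G(x(t);\xi_t),x\rangle+\tfrac1{\alpha(t)}D_\psi(x,x(t))\Big\},\qquad \hat x(T)=\frac1T\sum_{t=1}^Tx(t).$$ *Lipschitz assumption.* There is $L\ge 0$ such that $|F(x;\xi)-F(y;\xi)|\le L\|x-y\|$ for all $x,y\in\mathcal X$, both for $\Pi$-almost every $\xi$ and, for each $t\ge 1$, almost surely for $\xi=\xi_t$; and for each $t\ge1$, almost surely, $\|\mathsf G(x;\xi_t)\|_*\le L$ for all $x\in\mathcal X$. *Mixing assumption.* With $d_{\rm TV}(P,Q)=\int|p-q|\,d\mu$ ($p,q$ densities of $P,Q$ with respect to a dominating measure $\mu$), let the mixing time be $$\tau_{\rm mix}(P_{[s]},\epsilon)=\inf\{n\in\mathbb N,\ n\ge 1:\ d_{\rm TV}(P_{[s]}^{s+m},\Pi)\le\epsilon\text{ for all integers } m\ge n\}\in\mathbb N\cup\{\infty\}.$$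 There are a constant $\Gamma$ and finite values $\tau_{\rm mix}(P,\epsilon)$, right-continuous in $\epsilon>0$, such that for all $\epsilon>0$, all integers $s\ge 0$ and all $c\in\mathbb R$, $$P\big(\tau_{\rm mix}(P_{[s]},\epsilon)\ge\tau_{\rm mix}(P,\epsilon)+\Gamma c\big)\le e^{-c}.$$ **Theorem.** Under these assumptions let $T\ge1$ be an integer, $\delta\in(0,1)$, and $\tau(\epsilon,\delta)=\tau_{\rm mix}(P,\epsilon)+\Gamma\big(\log\frac2\delta+2\log T\big)$. With probability at least $1-\delta$, for every $x^\star\in\mathcal X$, $$f(\hat x(T))-f(x^\star)\le\inf_{\epsilon>0}\Big\{\frac{R^2}{2T\alpha(T)}+\frac{L^2}{2T}\sum_{t=1}^T\alpha(t)+\frac{\tau(\epsilon,\delta)-1}{T}\Big[L^2\sum_{t=1}^T\alpha(t)+LR\Big]+\epsilon LR+4LR\sqrt{\frac{\tau(\epsilon,\delta)\log\frac{\tau(\epsilon,\delta)}{\delta}}{T}}\Big\}.$$ -/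

import Mathlib

open MeasureTheory ProbabilityTheory

noncomputable section

namespace EMD

/-! ### Total variation, conditional laws and mixing times -/

section Mixing

variable {Ω Z : Type*} [MeasurableSpace Ω] [MeasurableSpace Z]

/-- Total variation distance `∫ |p - q| dμ` between two probability measures, where `p` and `q`
are the densities with respect to the dominating measure `μ = P + Q`. (It takes values in
`[0, 2]`.) -/
def tvDist (P Q : Measure Z) : ℝ :=
  ∫ z, |(P.rnDeriv (P + Q) z).toReal - (Q.rnDeriv (P + Q) z).toReal| ∂(P + Q)

/-- The first `s` samples `(ξ_1, …, ξ_s)`; they generate the σ-field `𝓕_s`. -/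
def past (ξ : ℕ → Ω → Z) (s : ℕ) (ω : Ω) : Finset.Icc 1 s → Z := fun i => ξ i ω

/-- `P_{[s]}^t`: the (regular) conditional distribution of `ξ_t` given `ξ_1, …, ξ_s`, a random
probability measure on `Z`. -/
def condLaw [StandardBorelSpace Z] [Nonempty Z] (P : Measure Ω) [IsFiniteMeasure P]
    (ξ : ℕ → Ω → Z) (s t : ℕ) (ω : Ω) : Measure Z :=
  condDistrib (ξ t) (past ξ s) P (past ξ s ω)

/-- The total variation mixing time of the process conditioned on the first `s` samples: the least
number `n ≥ 1` of additional steps from which on the conditional law of the sample is within `ε`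
of the stationary distribution (`⊤` if there is none). -/
def mixingTime [StandardBorelSpace Z] [Nonempty Z] (P : Measure Ω) [IsFiniteMeasure P]
    (ξ : ℕ → Ω → Z) (stat : Measure Z) (s : ℕ) (ε : ℝ) (ω : Ω) : EReal :=
  sInf {r : EReal | ∃ n : ℕ, 1 ≤ n ∧
    (∀ m : ℕ, n ≤ m → tvDist (condLaw P ξ s (s + m) ω) stat ≤ ε) ∧ r = ((n : ℝ) : EReal)}

/-- The mixing times are stochastically uniform, with uniform mixing time `tmix` and constant
`Γ`. -/
structure StochasticallyUniformMixing [StandardBorelSpace Z] [Nonempty Z] (P : Measure Ω)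
    [IsFiniteMeasure P] (ξ : ℕ → Ω → Z) (stat : Measure Z) (tmix : ℝ → ℝ) (Γ : ℝ) : Prop where
  right_continuous : ∀ ε : ℝ, 0 < ε → ContinuousWithinAt tmix (Set.Ioi ε) ε
  tail : ∀ ε : ℝ, 0 < ε → ∀ (s : ℕ) (c : ℝ),
    P.real {ω | ((tmix ε + Γ * c : ℝ) : EReal) ≤ mixingTime P ξ stat s ε ω} ≤ Real.exp (-c)

end Mixing

/-! ### Mirror descent

The space `ℝ^d` with an arbitrary norm is a finite-dimensional normed space `E`; subgradients live
in the dual `E →L[ℝ] ℝ`, whose operator norm is the dual norm. -/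

section MirrorDescent

variable {E : Type*} [NormedAddCommGroup E] [NormedSpace ℝ E]

/-- Bregman divergence of `ψ` on the convex domain `X`. For `x, y ∈ X` the value does not depend on
the choice of a derivative of `ψ` within `X`. -/
def bregman (ψ : E → ℝ) (X : Set E) (x y : E) : ℝ :=
  ψ x - ψ y - fderivWithin ℝ ψ X y (x - y)

/-- A prox-function: differentiable on `X` and `1`-strongly convex over `X` with respect to the
norm. -/
structure IsProx (ψ : E → ℝ) (X : Set E) : Prop where
  differentiableOn : DifferentiableOn ℝ ψ X
  strongly_convex : ∀ x ∈ X, ∀ y ∈ X,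
    ψ x + fderivWithin ℝ ψ X x (y - x) + (1 / 2) * ‖x - y‖ ^ 2 ≤ ψ y

/-- `g` is a subgradient at `x` of the function `h` on the domain `X`. -/
def IsSubgradient (X : Set E) (h : E → ℝ) (x : E) (g : E →L[ℝ] ℝ) : Prop :=
  ∀ y ∈ X, h x + g (y - x) ≤ h y

/-- `h` is `L`-Lipschitz over `X`. -/
def LipschitzOver (X : Set E) (L : ℝ) (h : E → ℝ) : Prop :=
  ∀ x ∈ X, ∀ y ∈ X, |h x - h y| ≤ L * ‖x - y‖

variable {Ω Z : Type*}

/-- `x(1), x(2), …` are the iterates of ergodic mirror descent started from the point `x₁`, with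
subgradients `g(t) = G(x(t); ξ_t)` and stepsizes `α(t)`. -/
structure IsErgodicMirrorDescent (X : Set E) (ψ : E → ℝ) (G : E → Z → E →L[ℝ] ℝ) (α : ℕ → ℝ)
    (ξ : ℕ → Ω → Z) (x₁ : E) (x : ℕ → Ω → E) : Prop where
  init_mem : x₁ ∈ X
  init : ∀ ω, x 1 ω = x₁
  mem : ∀ t, 1 ≤ t → ∀ ω, x (t + 1) ω ∈ X
  argmin : ∀ t, 1 ≤ t → ∀ ω,
    IsMinOn (fun u => G (x t ω) (ξ t ω) u + 1 / α t * bregman ψ X u (x t ω)) X (x (t + 1) ω)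

/-- The expected objective `f(x) = E_Π[F(x; ξ)]`. -/
def objective [MeasurableSpace Z] (F : E → Z → ℝ) (stat : Measure Z) (x : E) : ℝ :=
  ∫ z, F x z ∂stat

/-- The averaged iterate `(1/T) ∑_{t=1}^T x(t)`. -/
def average (x : ℕ → Ω → E) (T : ℕ) (ω : Ω) : E :=
  (1 / (T : ℝ)) • ∑ t ∈ Finset.Icc 1 T, x t ω

end MirrorDescent

/-- `τ(ε, δ) = τ_mix(ε) + Γ (log (2/δ) + 2 log T)`. -/
def tau (tmix : ℝ → ℝ) (Γ : ℝ) (T : ℕ) (ε δ : ℝ) : ℝ :=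
  tmix ε + Γ * (Real.log (2 / δ) + 2 * Real.log T)

/-- The right-hand side of the high-probability bound, with `τ` for the mixing time. -/
def rateBound (R L : ℝ) (α : ℕ → ℝ) (T : ℕ) (ε δ τ : ℝ) : ℝ :=
  R ^ 2 / (2 * T * α T) + L ^ 2 / (2 * T) * ∑ t ∈ Finset.Icc 1 T, α t
    + (τ - 1) / T * (L ^ 2 * ∑ t ∈ Finset.Icc 1 T, α t + L * R)
    + ε * L * R + 4 * L * R * Real.sqrt (τ * Real.log (τ / δ) / T)

end EMD

end

noncomputable section

namespace EMD

/-! ### Mirror descent along a fixed sample path: regret and drift. -/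

section Deterministic

variable {E : Type*} [NormedAddCommGroup E] [NormedSpace ℝ E] {X : Set E} {ψ : E → ℝ}

/-! Fix ε and a minimizer u of f over X. Given x(t), the sample ξ_t need not be close to Π in law,
so x(t) is paired with the later sample ξ_{t+m}. Then f(x(t)) − f(u) splits into three parts: the
regret F(x(t+m); ξ_{t+m}) − F(u; ξ_{t+m}), summed by the usual mirror descent analysis
(`IsProx.regret_le`); the change F(x(t); ξ_{t+m}) − F(x(t+m); ξ_{t+m}), small because m steps move
the iterate by at most mα(t)L (`IsProx.norm_drift_le`); and the deviation of the gap of f from the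
gap of F(·; ξ_{t+m}). The last m iterates have no partner and cost LR each, X having diameter at
most R (`IsProx.sum_gap_le`).

Since x(t) is a function of the first t − 1 samples, ξ_{t+m} is seen from there at lag n = m + 1.
Where its conditional law is within ε of Π, the deviation is at most εLR plus a centered bounded
increment that is revealed n steps late. Such increments form n interleaved martingale difference
sequences, and Jensen's inequality across them gives Azuma–Hoeffding with the exponent divided by n
(`measureReal_le_sum_le`).

The lag satisfies n < τ ≤ n + 1. The first inequality yields the coefficient τ − 1 and the
concentration exponent; the second, mixing times being integers, lets the tail hypothesis control
failure to mix at lag n. The increments deviate with probability at most δ/τ^4, and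
`StochasticallyUniformMixing.exists_prob_not_mixed_le` fits the non-mixing events into the rest of
δ, even for τ near 1. The infimum over ε costs no probability because the events for decreasing
levels are nested (`prob_iInf_lt_le`). -/

lemma IsProx.half_sq_le_bregman (hψ : IsProx ψ X) {x y : E} (hx : x ∈ X) (hy : y ∈ X) :
    1 / 2 * ‖x - y‖ ^ 2 ≤ bregman ψ X x y := by
  have h := hψ.strongly_convex y hy x hx
  rw [norm_sub_rev] at h
  unfold bregman
  linarith

lemma IsProx.norm_sub_le_radius (hψ : IsProx ψ X) {R : ℝ} (hR : 0 ≤ R)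
    (hrad : ∀ x ∈ X, ∀ y ∈ X, bregman ψ X x y ≤ (1 / 2) * R ^ 2) {x y : E} (hx : x ∈ X)
    (hy : y ∈ X) : ‖x - y‖ ≤ R := by
  have h1 := hψ.half_sq_le_bregman hx hy
  have h2 := hrad x hx y hy
  exact le_of_sq_le_sq (by linarith) hR

/-- First-order optimality condition of a mirror descent step. -/
lemma IsProx.first_order_optimality (hψ : IsProx ψ X) (hX : Convex ℝ X) {g : E →L[ℝ] ℝ} {a : ℝ}
    {y z u : E} (hz : z ∈ X) (hu : u ∈ X)
    (hmin : IsMinOn (fun v => g v + 1 / a * bregman ψ X v y) X z) :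
    0 ≤ g (u - z) + 1 / a * (fderivWithin ℝ ψ X z (u - z) - fderivWithin ℝ ψ X y (u - z)) := by
  have hd : HasFDerivWithinAt (fun v => g v + 1 / a * bregman ψ X v y)
      (g + (1 / a) • (fderivWithin ℝ ψ X z - fderivWithin ℝ ψ X y)) X z := by
    have h1 : HasFDerivWithinAt (fun v => bregman ψ X v y)
        (fderivWithin ℝ ψ X z - fderivWithin ℝ ψ X y) X z := by
      unfold bregman
      have h2 := (hψ.differentiableOn z hz).hasFDerivWithinAt
      have h3 : HasFDerivWithinAt (fun v => fderivWithin ℝ ψ X y (v - y)) (fderivWithin ℝ ψ X y)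
          X z := by
        have h4 := (fderivWithin ℝ ψ X y).hasFDerivWithinAt.comp z
          ((hasFDerivWithinAt_id z X).sub_const y) (Set.mapsTo_univ _ _)
        rwa [ContinuousLinearMap.comp_id] at h4
      exact (h2.sub_const (ψ y)).sub h3
    exact g.hasFDerivWithinAt.add (h1.const_mul (1 / a))
  have := hmin.localize.hasFDerivWithinAt_nonneg hd
    (sub_mem_posTangentConeAt_of_segment_subset (hX.segment_subset hz hu))
  simpa using this

variable {g : E →L[ℝ] ℝ} {a L : ℝ} {y z u : E}

/-- A mirror descent step has length at most `a L`. -/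
lemma IsProx.norm_step_le (hψ : IsProx ψ X) (hX : Convex ℝ X) (ha : 0 < a) (hg : ‖g‖ ≤ L)
    (hy : y ∈ X) (hz : z ∈ X) (hmin : IsMinOn (fun v => g v + 1 / a * bregman ψ X v y) X z) :
    ‖y - z‖ ≤ a * L := by
  have h := hψ.first_order_optimality hX hz hy hmin
  have h1 := hψ.strongly_convex y hy z hz
  have h2 := hψ.strongly_convex z hz y hy
  have h3 : fderivWithin ℝ ψ X y (z - y) = - fderivWithin ℝ ψ X y (y - z) := by
    rw [← map_neg, neg_sub]
  have h4 : g (y - z) ≤ L * ‖y - z‖ :=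
    (le_abs_self _).trans ((g.le_opNorm _).trans (by gcongr))
  rw [norm_sub_rev z y] at h2
  -- Strong convexity at y and at z adds up to strong monotonicity of the gradient; optimality of z
  -- is tested against y.
  have h5 : ‖y - z‖ ^ 2 ≤ a * (L * ‖y - z‖) := by
    have h6 : 1 / a * ‖y - z‖ ^ 2 ≤ L * ‖y - z‖ := by
      have : 1 / a * (fderivWithin ℝ ψ X z (y - z) - fderivWithin ℝ ψ X y (y - z))
          ≤ 1 / a * (- ‖y - z‖ ^ 2) := by
        gcongr; linarith
      linarith
    calc ‖y - z‖ ^ 2 = a * (1 / a * ‖y - z‖ ^ 2) := by field_simp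
      _ ≤ _ := by gcongr
  rcases (norm_nonneg (y - z)).eq_or_lt with h0 | h0
  · rw [← h0]; exact mul_nonneg ha.le ((norm_nonneg g).trans hg)
  · nlinarith

/-- The one-step regret bound of mirror descent. -/
lemma IsProx.step_regret_le (hψ : IsProx ψ X) (hX : Convex ℝ X) (ha : 0 < a) (hg : ‖g‖ ≤ L)
    (hy : y ∈ X) (hz : z ∈ X) (hu : u ∈ X)
    (hmin : IsMinOn (fun v => g v + 1 / a * bregman ψ X v y) X z) :
    g (y - u) ≤ 1 / a * (bregman ψ X u y - bregman ψ X u z) + L ^ 2 / 2 * a := by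
  have h := hψ.first_order_optimality hX hz hu hmin
  have h1 := hψ.half_sq_le_bregman hz hy
  have h4 : g (y - z) ≤ L * ‖z - y‖ := by
    rw [norm_sub_rev]
    exact (le_abs_self _).trans ((g.le_opNorm _).trans (by gcongr))
  have h5 : g (y - u) = g (y - z) - g (u - z) := by rw [← map_sub]; congr 1; abel
  -- Three-point identity for Bregman divergences.
  have h6 : fderivWithin ℝ ψ X z (u - z) - fderivWithin ℝ ψ X y (u - z)
      = bregman ψ X u y - bregman ψ X u z - bregman ψ X z y := by
    have : fderivWithin ℝ ψ X y (u - z)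
        = fderivWithin ℝ ψ X y (u - y) - fderivWithin ℝ ψ X y (z - y) := by
      rw [← map_sub]; congr 1; abel
    unfold bregman
    rw [this]; ring
  -- Young's inequality, weighted so that the quadratic term is absorbed by the divergence of the
  -- step.
  have h7 : L * ‖z - y‖ ≤ L ^ 2 / 2 * a + 1 / a * (1 / 2 * ‖z - y‖ ^ 2) := by
    have : L ^ 2 / 2 * a + 1 / a * (1 / 2 * ‖z - y‖ ^ 2) - L * ‖z - y‖
        = (L * a - ‖z - y‖) ^ 2 / (2 * a) := by field_simp; ring
    have h8 : 0 ≤ (L * a - ‖z - y‖) ^ 2 / (2 * a) := by positivity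
    linarith
  have h8 : 1 / a * (1 / 2 * ‖z - y‖ ^ 2) ≤ 1 / a * bregman ψ X z y := by gcongr
  rw [h6] at h
  rw [h5]
  have h9 : 1 / a * (bregman ψ X u y - bregman ψ X u z - bregman ψ X z y)
      = 1 / a * (bregman ψ X u y - bregman ψ X u z) - 1 / a * bregman ψ X z y := by ring
  linarith

/-- Abel summation with nonincreasing stepsizes. -/
lemma sum_div_step_le {a b : ℕ → ℝ} {B : ℝ} (ha : ∀ t, 0 < a t) (hanti : Antitone a)
    (hb : ∀ t, b t ≤ B) (m N : ℕ) :
    ∑ i ∈ Finset.range (N + 1), 1 / a (m + i) * (b (m + i) - b (m + i + 1))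
      ≤ 1 / a (m + N) * (B - b (m + N + 1)) := by
  induction N with
  | zero =>
    simp only [zero_add, Finset.range_one, Finset.sum_singleton, add_zero]
    have := hb m
    have := ha m
    gcongr
  | succ N ih =>
    rw [Finset.sum_range_succ]
    -- As 1/a is nondecreasing and B − b is nonnegative, the leftover may be reweighted with the
    -- next factor, after which it telescopes.
    have h1 : 1 / a (m + N) * (B - b (m + N + 1)) ≤ 1 / a (m + (N + 1)) * (B - b (m + N + 1)) :=
      mul_le_mul_of_nonneg_right (one_div_le_one_div_of_le (ha _) (hanti (by omega)))
        (by linarith [hb (m + N + 1)])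
    have h2 : m + (N + 1) = m + N + 1 := by omega
    rw [h2] at h1 ⊢
    linarith

variable {y : ℕ → E} {g : ℕ → E →L[ℝ] ℝ} {a : ℕ → ℝ}

/-- The iterates drift slowly. -/
lemma IsProx.norm_drift_le (hψ : IsProx ψ X) (hX : Convex ℝ X) (ha : ∀ t, 0 < a t)
    (hanti : Antitone a) (hL : 0 ≤ L) (hy : ∀ t, y t ∈ X)
    (hmin : ∀ t, IsMinOn (fun v => g t v + 1 / a t * bregman ψ X v (y t)) X (y (t + 1)))
    (t m : ℕ) (hg : ∀ s, s < t + m → ‖g s‖ ≤ L) :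
    ‖y t - y (t + m)‖ ≤ m * (a t * L) := by
  induction m with
  | zero => simp
  | succ m ih =>
    have h1 := ih fun s hs => hg s (by omega)
    have h2 := hψ.norm_step_le hX (ha (t + m)) (hg (t + m) (by omega)) (hy _) (hy _) (hmin (t + m))
    have h3 : a (t + m) * L ≤ a t * L := by gcongr; exact hanti (by omega)
    calc ‖y t - y (t + (m + 1))‖
        = ‖(y t - y (t + m)) + (y (t + m) - y (t + m + 1))‖ := by
          rw [sub_add_sub_cancel]; rfl
      _ ≤ ‖y t - y (t + m)‖ + ‖y (t + m) - y (t + m + 1)‖ := norm_add_le _ _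
      _ ≤ _ := by push_cast; linarith

/-- The regret bound of mirror descent on the window `m, …, m + N`. -/
lemma IsProx.regret_le (hψ : IsProx ψ X) (hX : Convex ℝ X) (ha : ∀ t, 0 < a t)
    (hanti : Antitone a) (hy : ∀ t, y t ∈ X)
    (hmin : ∀ t, IsMinOn (fun v => g t v + 1 / a t * bregman ψ X v (y t)) X (y (t + 1)))
    {R : ℝ} (hrad : ∀ x ∈ X, ∀ y ∈ X, bregman ψ X x y ≤ (1 / 2) * R ^ 2) (hu : u ∈ X)
    (m N : ℕ) (hg : ∀ s, s < m + (N + 1) → ‖g s‖ ≤ L) :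
    ∑ i ∈ Finset.range (N + 1), g (m + i) (y (m + i) - u)
      ≤ R ^ 2 / (2 * a (m + N)) + L ^ 2 / 2 * ∑ i ∈ Finset.range (N + 1), a (m + i) := by
  have h1 : ∀ i ∈ Finset.range (N + 1), g (m + i) (y (m + i) - u)
      ≤ 1 / a (m + i) * (bregman ψ X u (y (m + i)) - bregman ψ X u (y (m + i + 1)))
        + L ^ 2 / 2 * a (m + i) := fun i hi =>
    hψ.step_regret_le hX (ha _) (hg _ (by simp at hi; omega)) (hy _) (hy _) hu (hmin _)
  have h2 := sum_div_step_le (b := fun t => bregman ψ X u (y t)) ha hanti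
    (fun t => hrad u hu _ (hy t)) m N
  have h3 : 1 / a (m + N) * (1 / 2 * R ^ 2 - bregman ψ X u (y (m + N + 1)))
      ≤ R ^ 2 / (2 * a (m + N)) := by
    have h4 : 0 ≤ bregman ψ X u (y (m + N + 1)) :=
      le_trans (by positivity) (hψ.half_sq_le_bregman hu (hy _))
    calc _ ≤ 1 / a (m + N) * (1 / 2 * R ^ 2) := by
          have := ha (m + N)
          gcongr; linarith
      _ = _ := by have := (ha (m + N)).ne'; field_simp
  refine (Finset.sum_le_sum h1).trans ?_
  rw [Finset.sum_add_distrib, ← Finset.mul_sum]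
  linarith

/-- The optimality gap of the iterates, up to the deviation between the objective and the sample
functions `m` steps later. -/
lemma IsProx.sum_gap_le (hψ : IsProx ψ X) (hX : Convex ℝ X) (ha : ∀ t, 0 < a t)
    (hanti : Antitone a) (hL : 0 ≤ L) (hy : ∀ t, y t ∈ X)
    (hmin : ∀ t, IsMinOn (fun v => g t v + 1 / a t * bregman ψ X v (y t)) X (y (t + 1)))
    {R : ℝ} (hR : 0 ≤ R) (hrad : ∀ x ∈ X, ∀ y ∈ X, bregman ψ X x y ≤ (1 / 2) * R ^ 2)
    (hu : u ∈ X) {f : E → ℝ} (hf : LipschitzOver X L f) {h : ℕ → E → ℝ} (m N : ℕ)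
    (hg : ∀ s, s < m + (N + 1) → ‖g s‖ ≤ L) (hh : ∀ s, s < m + (N + 1) → LipschitzOver X L (h s))
    (hsub : ∀ s, IsSubgradient X (h s) (y s) (g s)) :
    ∑ t ∈ Finset.range (m + (N + 1)), (f (y t) - f u)
      ≤ ∑ t ∈ Finset.range (N + 1), ((f (y t) - f u) - (h (m + t) (y t) - h (m + t) u))
        + m * (L ^ 2 * ∑ t ∈ Finset.range (m + (N + 1)), a t + L * R)
        + R ^ 2 / (2 * a (m + N)) + L ^ 2 / 2 * ∑ t ∈ Finset.range (m + (N + 1)), a t := by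
  have e1 : ∑ t ∈ Finset.range (m + (N + 1)), (f (y t) - f u)
      = ∑ t ∈ Finset.range (N + 1), (f (y t) - f u)
        + ∑ i ∈ Finset.range m, (f (y (N + 1 + i)) - f u) := by
    rw [add_comm m, Finset.sum_range_add]
  have e2 : ∑ i ∈ Finset.range m, (f (y (N + 1 + i)) - f u) ≤ m * (L * R) := by
    calc _ ≤ ∑ i ∈ Finset.range m, L * R := by
          refine Finset.sum_le_sum fun i _ => (le_abs_self _).trans ((hf _ (hy _) _ hu).trans ?_)
          gcongr
          exact hψ.norm_sub_le_radius hR hrad (hy _) hu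
      _ = _ := by simp
  have e3 : ∑ t ∈ Finset.range (N + 1), (h (m + t) (y t) - h (m + t) (y (m + t)))
      ≤ m * (L ^ 2 * ∑ t ∈ Finset.range (N + 1), a t) := by
    rw [Finset.mul_sum, Finset.mul_sum]
    refine Finset.sum_le_sum fun t ht => ?_
    simp only [Finset.mem_range] at ht
    have h1 := hψ.norm_drift_le hX ha hanti hL hy hmin t m fun s hs => hg s (by omega)
    rw [add_comm t m] at h1
    calc _ ≤ L * ‖y t - y (m + t)‖ :=
          (le_abs_self _).trans (hh _ (by omega) _ (hy _) _ (hy _))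
      _ ≤ L * (m * (a t * L)) := by gcongr
      _ = _ := by ring
  have e4 : ∑ t ∈ Finset.range (N + 1), (h (m + t) (y (m + t)) - h (m + t) u)
      ≤ R ^ 2 / (2 * a (m + N)) + L ^ 2 / 2 * ∑ i ∈ Finset.range (N + 1), a (m + i) := by
    refine le_trans (Finset.sum_le_sum fun t _ => ?_)
      (hψ.regret_le hX ha hanti hy hmin hrad hu m N hg)
    have h1 := hsub (m + t) u hu
    have h2 : g (m + t) (u - y (m + t)) = - g (m + t) (y (m + t) - u) := by
      rw [← map_neg, neg_sub]
    linarith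
  have e5 : ∑ i ∈ Finset.range (N + 1), a (m + i) ≤ ∑ t ∈ Finset.range (m + (N + 1)), a t := by
    rw [Finset.sum_range_add a m (N + 1)]
    have : 0 ≤ ∑ t ∈ Finset.range m, a t := Finset.sum_nonneg fun t _ => (ha t).le
    linarith
  have e6 : ∑ t ∈ Finset.range (N + 1), a t ≤ ∑ t ∈ Finset.range (m + (N + 1)), a t :=
    Finset.sum_le_sum_of_subset_of_nonneg (Finset.range_mono (by omega)) fun t _ _ => (ha t).le
  have e7 : ∑ t ∈ Finset.range (N + 1), (f (y t) - f u)
      = ∑ t ∈ Finset.range (N + 1), ((f (y t) - f u) - (h (m + t) (y t) - h (m + t) u))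
        + ∑ t ∈ Finset.range (N + 1), (h (m + t) (y t) - h (m + t) (y (m + t)))
        + ∑ t ∈ Finset.range (N + 1), (h (m + t) (y (m + t)) - h (m + t) u) := by
    rw [← Finset.sum_add_distrib, ← Finset.sum_add_distrib]
    exact Finset.sum_congr rfl fun t _ => by ring
  have e8 : (m : ℝ) * (L ^ 2 * ∑ t ∈ Finset.range (N + 1), a t)
      ≤ m * (L ^ 2 * ∑ t ∈ Finset.range (m + (N + 1)), a t) := by gcongr
  have e9 : L ^ 2 / 2 * ∑ i ∈ Finset.range (N + 1), a (m + i)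
      ≤ L ^ 2 / 2 * ∑ t ∈ Finset.range (m + (N + 1)), a t := by gcongr
  rw [e1, e7, mul_add]
  linarith

section

variable {Ω Z : Type*} {G : E → Z → E →L[ℝ] ℝ} {α : ℕ → ℝ} {ξ : ℕ → Ω → Z} {x₁ : E} {x : ℕ → Ω → E}

lemma IsErgodicMirrorDescent.mem_domain (hx : IsErgodicMirrorDescent X ψ G α ξ x₁ x) (t : ℕ)
    (ω : Ω) : x (t + 1) ω ∈ X := by
  rcases t with _ | t
  · rw [zero_add, hx.init]; exact hx.init_mem
  · exact hx.mem (t + 1) (by omega) ω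

end

end Deterministic

/-! ### Measurability and adaptedness of the iterates. -/

section Measurability

open Filter Topology

variable {E : Type*} [NormedAddCommGroup E] [NormedSpace ℝ E]
  [MeasurableSpace E] [BorelSpace E] {X : Set E} {ψ : E → ℝ}

lemma IsProx.measurable_comp (hψ : IsProx ψ X) {Ω : Type*} [MeasurableSpace Ω] {y : Ω → E}
    (hy : Measurable y) (hyX : ∀ ω, y ω ∈ X) : Measurable fun ω => ψ (y ω) :=
  (continuousOn_iff_continuous_domRestrict.1 hψ.differentiableOn.continuousOn).measurable.comp
    (hy.subtype_mk (h := hyX))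

variable [FiniteDimensional ℝ E]

/-- A minimizer with quadratic growth of a Carathéodory function is measurable. -/
lemma measurable_argmin {Ω : Type*} [MeasurableSpace Ω] {Φ : Ω → E → ℝ} {z : Ω → E} {c : ℝ}
    (hc : 0 < c) (hΦm : ∀ u ∈ X, Measurable fun ω => Φ ω u) (hΦc : ∀ ω, ContinuousOn (Φ ω) X)
    (hz : ∀ ω, z ω ∈ X) (hgrowth : ∀ ω, ∀ u ∈ X, c * ‖u - z ω‖ ^ 2 ≤ Φ ω u - Φ ω (z ω)) :
    Measurable z := by
  classical
  rcases isEmpty_or_nonempty Ω with hΩ | ⟨⟨ω₀⟩⟩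
  · exact measurable_of_empty z
  have : SecondCountableTopology E := secondCountable_of_proper (α := E)
  have : Nonempty X := ⟨⟨z ω₀, hz ω₀⟩⟩
  let d : ℕ → X := TopologicalSpace.denseSeq X
  have hV : ∀ ω, IsGLB (Set.range fun k => Φ ω (d k)) (Φ ω (z ω)) := by
    intro ω
    constructor
    · rintro _ ⟨k, rfl⟩
      have h1 := hgrowth ω (d k) (d k).2
      have h2 : 0 ≤ c * ‖(d k : E) - z ω‖ ^ 2 := by positivity
      simp only
      linarith
    · intro b hb
      have hcl : IsClosed {u : X | b ≤ Φ ω u} :=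
        isClosed_le continuous_const (continuousOn_iff_continuous_domRestrict.1 (hΦc ω))
      exact (TopologicalSpace.denseRange_denseSeq X).induction_on
        (p := fun u : X => b ≤ Φ ω u) ⟨z ω, hz ω⟩ hcl fun k => hb ⟨k, rfl⟩
  have hVm : Measurable fun ω => Φ ω (z ω) := by
    have : (fun ω => Φ ω (z ω)) = fun ω => ⨅ k, Φ ω (d k) :=
      funext fun ω => ((hV ω).ciInf_eq).symm
    rw [this]
    exact Measurable.iInf fun k => hΦm _ (d k).2
  -- The first point of a countable dense set that is 1/(n+1)-optimal is a measurable choice;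
  -- quadratic growth makes these choices converge to the minimizer.
  have hex : ∀ n : ℕ, ∀ ω, ∃ k, Φ ω (d k) < Φ ω (z ω) + 1 / ((n : ℝ) + 1) := by
    intro n ω
    obtain ⟨_, ⟨k, rfl⟩, hk⟩ := (isGLB_lt_iff (hV ω)).1
      (lt_add_of_pos_right (Φ ω (z ω)) (Nat.one_div_pos_of_nat (n := n)))
    exact ⟨k, hk⟩
  have hfind : ∀ n, Measurable fun ω => Nat.find (hex n ω) := fun n =>
    measurable_find (hex n) fun k => measurableSet_lt (hΦm _ (d k).2) (hVm.add_const _)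
  refine measurable_of_tendsto_metrizable
    (f := fun n ω => ((d (Nat.find (hex n ω)) : X) : E)) (fun n => ?_) ?_
  · exact (measurable_from_nat (f := fun k => ((d k : X) : E))).comp (hfind n)
  · rw [tendsto_pi_nhds]
    intro ω
    rw [tendsto_iff_norm_sub_tendsto_zero]
    have hsq : Tendsto (fun n : ℕ => Real.sqrt (1 / c * (1 / ((n : ℝ) + 1)))) atTop (𝓝 0) := by
      have := (tendsto_one_div_add_atTop_nhds_zero_nat (𝕜 := ℝ)).const_mul (1 / c)
      have := (Real.continuous_sqrt.tendsto _).comp this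
      simpa [Function.comp_def] using this
    refine squeeze_zero (fun n => norm_nonneg _) (fun n => ?_) hsq
    apply Real.le_sqrt_of_sq_le
    have h1 := hgrowth ω _ (d (Nat.find (hex n ω))).2
    have h2 := Nat.find_spec (hex n ω)
    have h3 : c * ‖((d (Nat.find (hex n ω)) : X) : E) - z ω‖ ^ 2 ≤ 1 / ((n : ℝ) + 1) := by linarith
    rw [div_mul_eq_mul_div, one_mul, le_div_iff₀ hc, mul_comm]
    exact h3

/-- The derivative of ψ at y in the direction u − y is the limit of difference quotients along the
segment from y to u, each measurable in y. -/
lemma IsProx.measurable_bregman (hψ : IsProx ψ X) (hX : Convex ℝ X) {Ω : Type*}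
    [MeasurableSpace Ω] {y : Ω → E} (hy : Measurable y) (hyX : ∀ ω, y ω ∈ X) {u : E} (hu : u ∈ X) :
    Measurable fun ω => bregman ψ X u (y ω) := by
  have hmem : ∀ (n : ℕ) ω, y ω + (1 / ((n : ℝ) + 1)) • (u - y ω) ∈ X := fun n ω =>
    hX.add_smul_sub_mem (hyX ω) hu ⟨by positivity, by
      rw [div_le_one (by positivity)]; linarith [n.cast_nonneg (α := ℝ)]⟩
  have hd : Measurable fun ω => fderivWithin ℝ ψ X (y ω) (u - y ω) := by
    refine measurable_of_tendsto_metrizable (f := fun (n : ℕ) ω =>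
      ((n : ℝ) + 1) • (ψ (y ω + (1 / ((n : ℝ) + 1)) • (u - y ω)) - ψ (y ω))) (fun n => ?_) ?_
    · exact ((hψ.measurable_comp (by fun_prop) (hmem n)).sub
        (hψ.measurable_comp hy hyX)).const_smul ((n : ℝ) + 1)
    · rw [tendsto_pi_nhds]
      intro ω
      refine (hψ.differentiableOn _ (hyX ω)).hasFDerivWithinAt.lim ?_
        (Eventually.of_forall fun n => hmem n ω) ?_
      · simpa using (tendsto_one_div_add_atTop_nhds_zero_nat (𝕜 := ℝ)).smul_const (u - y ω)
      · refine tendsto_const_nhds.congr fun n => ?_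
        rw [smul_smul, mul_one_div_cancel (by positivity), one_smul]
  exact (measurable_const.sub (hψ.measurable_comp hy hyX)).sub hd

/-- A mirror descent step depends measurably on the subgradient and the current point. -/
lemma IsProx.measurable_step (hψ : IsProx ψ X) (hX : Convex ℝ X) {Ω : Type*} [MeasurableSpace Ω]
    {g : Ω → E →L[ℝ] ℝ} {y z : Ω → E} {a : ℝ} (ha : 0 < a) (hg : Measurable g) (hy : Measurable y)
    (hyX : ∀ ω, y ω ∈ X) (hzX : ∀ ω, z ω ∈ X)
    (hmin : ∀ ω, IsMinOn (fun v => g ω v + 1 / a * bregman ψ X v (y ω)) X (z ω)) :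
    Measurable z := by
  refine measurable_argmin (X := X) (c := 1 / (2 * a)) (by positivity)
    (Φ := fun ω v => g ω v + 1 / a * bregman ψ X v (y ω)) ?_ ?_ hzX ?_
  · intro u hu
    exact ((ContinuousLinearMap.measurable_apply u).comp hg).add
      ((hψ.measurable_bregman hX hy hyX hu).const_mul (1 / a))
  · intro ω
    have h1 : ContinuousOn ψ X := hψ.differentiableOn.continuousOn
    unfold bregman
    fun_prop
  · intro ω u hu
    have h := hψ.first_order_optimality hX (hzX ω) hu (hmin ω)
    have h1 := hψ.half_sq_le_bregman hu (hzX ω)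
    -- By the three-point identity, optimality leaves a surplus of D(u, z)/a, hence growth ‖u −
    -- z‖²/(2a).
    have h2 : fderivWithin ℝ ψ X (z ω) (u - z ω) - fderivWithin ℝ ψ X (y ω) (u - z ω)
        = bregman ψ X u (y ω) - bregman ψ X u (z ω) - bregman ψ X (z ω) (y ω) := by
      have : fderivWithin ℝ ψ X (y ω) (u - z ω)
          = fderivWithin ℝ ψ X (y ω) (u - y ω) - fderivWithin ℝ ψ X (y ω) (z ω - y ω) := by
        rw [← map_sub]; congr 1; abel
      unfold bregman
      rw [this]; ring
    have h3 : 1 / (2 * a) * ‖u - z ω‖ ^ 2 ≤ 1 / a * bregman ψ X u (z ω) := by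
      calc _ = 1 / a * (1 / 2 * ‖u - z ω‖ ^ 2) := by field_simp
        _ ≤ _ := by gcongr
    rw [h2] at h
    have h4 : g ω (u - z ω) = g ω u - g ω (z ω) := map_sub _ _ _
    linarith

variable {Ω Z : Type*} [MeasurableSpace Z]

lemma measurable_past [MeasurableSpace Ω] {ξ : ℕ → Ω → Z} (hξ : ∀ t, Measurable (ξ t)) (s : ℕ) :
    Measurable (past ξ s) :=
  measurable_pi_lambda _ fun i => hξ i

lemma comap_past_mono (ξ : ℕ → Ω → Z) {s t : ℕ} (hst : s ≤ t) :
    MeasurableSpace.comap (past ξ s) inferInstance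
      ≤ MeasurableSpace.comap (past ξ t) inferInstance := by
  rw [← measurable_iff_comap_le]
  let _ : MeasurableSpace Ω := MeasurableSpace.comap (past ξ t) inferInstance
  refine measurable_pi_lambda _ fun i => ?_
  have hi : (i : ℕ) ∈ Finset.Icc 1 t := by
    have := Finset.mem_Icc.1 i.2
    exact Finset.mem_Icc.2 ⟨this.1, this.2.trans hst⟩
  exact (measurable_pi_apply (⟨i, hi⟩ : Finset.Icc 1 t)).comp (comap_measurable (past ξ t))

lemma measurable_sample_past (ξ : ℕ → Ω → Z) {s t : ℕ} (hs : 1 ≤ s) (hst : s ≤ t) :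
    Measurable[MeasurableSpace.comap (past ξ t) inferInstance] (ξ s) :=
  (measurable_pi_apply (⟨s, Finset.mem_Icc.2 ⟨hs, hst⟩⟩ : Finset.Icc 1 t)).comp
    (comap_measurable (past ξ t))

variable {G : E → Z → E →L[ℝ] ℝ} {α : ℕ → ℝ} {ξ : ℕ → Ω → Z} {x₁ : E} {x : ℕ → Ω → E}

/-- The iterates are adapted: `x(t + 1)` is a function of the first `t` samples. -/
lemma IsErgodicMirrorDescent.measurable_past (hx : IsErgodicMirrorDescent X ψ G α ξ x₁ x)
    (hψ : IsProx ψ X) (hX : Convex ℝ X) (hG : Measurable (Function.uncurry G))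
    (hα : ∀ t, 1 ≤ t → 0 < α t) (t : ℕ) :
    Measurable[MeasurableSpace.comap (past ξ t) inferInstance] (x (t + 1)) := by
  induction t with
  | zero =>
    have : x (0 + 1) = fun _ => x₁ := funext hx.init
    rw [this]
    exact measurable_const
  | succ t ih =>
    let _ : MeasurableSpace Ω := MeasurableSpace.comap (past ξ (t + 1)) inferInstance
    have hy : Measurable (x (t + 1)) := ih.mono (comap_past_mono ξ (by omega)) le_rfl
    have hs : Measurable (ξ (t + 1)) := measurable_sample_past ξ (by omega) le_rfl
    exact hψ.measurable_step hX (hα (t + 1) (by omega)) (hG.comp (hy.prodMk hs)) hy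
      (hx.mem_domain t) (hx.mem_domain (t + 1)) (hx.argmin (t + 1) (by omega))

end Measurability

/-! ### Azuma–Hoeffding for increments revealed with a delay. -/

section Concentration

variable {Ω : Type*} {m mΩ : MeasurableSpace Ω} {P : Measure Ω}

/-- `D` has conditionally sub-Gaussian exponential moments with respect to the σ-field `m`, with
variance proxy `v`. -/
def CondExpMomentBound (m : MeasurableSpace Ω) {mΩ : MeasurableSpace Ω} (P : Measure Ω) (D : Ω → ℝ)
    (v : ℝ) : Prop :=
  ∀ (r : ℝ) (h : Ω → ENNReal), Measurable[m] h →
    ∫⁻ ω, h ω * ENNReal.ofReal (Real.exp (r * D ω)) ∂P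
      ≤ ENNReal.ofReal (Real.exp (v * r ^ 2 / 2)) * ∫⁻ ω, h ω ∂P

/-- Hoeffding's lemma for the deviation of a bounded function of a random variable from its
conditional expectation. -/
lemma condExpMomentBound_of_condDistrib [IsProbabilityMeasure P] {A Z : Type*} [MeasurableSpace A]
    [MeasurableSpace Z] [StandardBorelSpace Z] [Nonempty Z] {Y : Ω → A} (hY : Measurable Y)
    {ζ : Ω → Z} (hζ : Measurable ζ) {φ : A → Z → ℝ} (hφ : Measurable (Function.uncurry φ)) {c : ℝ}
    (hc : ∀ a z, φ a z ∈ Set.Icc (-c) c) :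
    CondExpMomentBound (MeasurableSpace.comap Y inferInstance) P
      (fun ω => ∫ z, φ (Y ω) z ∂(condDistrib ζ Y P (Y ω)) - φ (Y ω) (ζ ω)) (c ^ 2) := by
  intro r h hh
  -- The weight is a function of Y, so it is constant once Y is frozen and Hoeffding's lemma applies
  -- under each conditional law.
  obtain ⟨h', hh', rfl⟩ := hh.exists_eq_measurable_comp
  have hint : Measurable fun a => ∫ z, φ a z ∂(condDistrib ζ Y P a) :=
    (StronglyMeasurable.integral_condDistrib (Y := ζ) (X := Y) (μ := P)
      hφ.stronglyMeasurable).measurable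
  have hφa : ∀ a, Measurable (φ a) := fun a => hφ.comp measurable_prodMk_left
  have hk : Measurable fun p : A × Z => h' p.1 * ENNReal.ofReal (Real.exp
      (r * (∫ z, φ p.1 z ∂(condDistrib ζ Y P p.1) - φ p.1 p.2))) := by
    have h1 : Measurable fun p : A × Z => φ p.1 p.2 := hφ
    have h2 : Measurable fun p : A × Z => ∫ z, φ p.1 z ∂(condDistrib ζ Y P p.1) :=
      hint.comp measurable_fst
    exact (hh'.comp measurable_fst).mul
      (((h2.sub h1).const_mul r).exp.ennreal_ofReal)
  have hin : ∀ a, ∫⁻ z, ENNReal.ofReal (Real.exp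
      (r * (∫ z, φ a z ∂(condDistrib ζ Y P a) - φ a z))) ∂(condDistrib ζ Y P a)
      ≤ ENNReal.ofReal (Real.exp (c ^ 2 * r ^ 2 / 2)) := by
    intro a
    have hs := hasSubgaussianMGF_of_mem_Icc (μ := condDistrib ζ Y P a) (hφa a).aemeasurable
      (Filter.Eventually.of_forall (hc a))
    have hi := hs.integrable_exp_mul (-r)
    have hm := hs.mgf_le (-r)
    have he : ∀ z, r * (∫ z, φ a z ∂(condDistrib ζ Y P a) - φ a z)
        = -r * (φ a z - ∫ z, φ a z ∂(condDistrib ζ Y P a)) := fun z => by ring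
    simp_rw [he]
    rw [← ofReal_integral_eq_lintegral_ofReal hi
      (Filter.Eventually.of_forall fun _ => (Real.exp_pos _).le)]
    refine ENNReal.ofReal_le_ofReal (hm.trans (le_of_eq ?_))
    congr 1
    -- An interval of length 2c has Hoeffding variance proxy (2c/2)² = c².
    have hcc : c - -c = 2 * c := by ring
    simp only [NNReal.coe_pow, NNReal.coe_div, coe_nnnorm, NNReal.coe_ofNat, Real.norm_eq_abs, hcc]
    rw [div_pow, sq_abs]
    ring
  calc ∫⁻ ω, (h' ∘ Y) ω * ENNReal.ofReal (Real.exp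
        (r * (∫ z, φ (Y ω) z ∂(condDistrib ζ Y P (Y ω)) - φ (Y ω) (ζ ω)))) ∂P
      = ∫⁻ p, h' p.1 * ENNReal.ofReal (Real.exp
        (r * (∫ z, φ p.1 z ∂(condDistrib ζ Y P p.1) - φ p.1 p.2))) ∂(P.map fun ω => (Y ω, ζ ω)) := by
        rw [lintegral_map hk (hY.prodMk hζ)]; rfl
    _ = ∫⁻ a, ∫⁻ z, h' a * ENNReal.ofReal (Real.exp
        (r * (∫ z, φ a z ∂(condDistrib ζ Y P a) - φ a z))) ∂(condDistrib ζ Y P a) ∂(P.map Y) := by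
        rw [← compProd_map_condDistrib hζ.aemeasurable, Measure.lintegral_compProd hk]
    _ ≤ ∫⁻ a, h' a * ENNReal.ofReal (Real.exp (c ^ 2 * r ^ 2 / 2)) ∂(P.map Y) := by
        refine lintegral_mono fun a => ?_
        rw [lintegral_const_mul _ (((hφa a).const_sub _ |>.const_mul r).exp.ennreal_ofReal)]
        gcongr
        exact hin a
    _ = _ := by
        rw [lintegral_mul_const _ hh', lintegral_map hh' hY, mul_comm]; rfl

variable {D : ℕ → Ω → ℝ} {𝓕 : ℕ → MeasurableSpace Ω} {v : ℝ} {n : ℕ}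

lemma condExpMomentBound_zero (hv : 0 ≤ v) : CondExpMomentBound m P (fun _ => 0) v := by
  intro r h _
  simp only [mul_zero, Real.exp_zero, ENNReal.ofReal_one, mul_one]
  exact le_mul_of_one_le_left' (by
    rw [ENNReal.one_le_ofReal]; exact Real.one_le_exp (by positivity))

/-- Exponential moments along an arithmetic progression of step `n`, for increments that are
known after a delay of `n` steps. -/
lemma lintegral_exp_progression_le [IsProbabilityMeasure P] (hmono : Monotone 𝓕)
    (hmeas : ∀ t, Measurable[𝓕 (t + n)] (D t)) (hD : ∀ t, CondExpMomentBound (𝓕 t) P (D t) v)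
    (r : ℝ) (j q : ℕ) :
    ∫⁻ ω, ENNReal.ofReal (Real.exp (r * ∑ k ∈ Finset.range q, D (j + k * n) ω)) ∂P
      ≤ ENNReal.ofReal (Real.exp (q * (v * r ^ 2 / 2))) := by
  induction q with
  | zero => simp
  | succ q ih =>
    -- Spacing n equals the delay, so all earlier increments of the progression are known at time j
    -- + qn and their exponential can serve as the weight.
    have hm : Measurable[𝓕 (j + q * n)] fun ω =>
        ENNReal.ofReal (Real.exp (r * ∑ k ∈ Finset.range q, D (j + k * n) ω)) := by
      refine ((Measurable.const_mul ?_ r).exp).ennreal_ofReal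
      refine Finset.measurable_sum _ fun k hk => (hmeas _).mono (hmono ?_) le_rfl
      have : k + 1 ≤ q := Finset.mem_range.1 hk
      nlinarith
    have h1 := hD (j + q * n) r _ hm
    calc _ = ∫⁻ ω, ENNReal.ofReal (Real.exp (r * ∑ k ∈ Finset.range q, D (j + k * n) ω))
          * ENNReal.ofReal (Real.exp (r * D (j + q * n) ω)) ∂P := by
          refine lintegral_congr fun ω => ?_
          rw [Finset.sum_range_succ, mul_add, Real.exp_add, ENNReal.ofReal_mul (Real.exp_pos _).le]
      _ ≤ _ := h1
      _ ≤ ENNReal.ofReal (Real.exp (v * r ^ 2 / 2))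
          * ENNReal.ofReal (Real.exp (q * (v * r ^ 2 / 2))) := by gcongr
      _ = _ := by
          rw [← ENNReal.ofReal_mul (Real.exp_pos _).le, ← Real.exp_add]
          congr 2; push_cast; ring

lemma sum_range_mul_eq_sum_progressions (a : ℕ → ℝ) (n q : ℕ) :
    ∑ t ∈ Finset.range (q * n), a t
      = ∑ j ∈ Finset.range n, ∑ k ∈ Finset.range q, a (j + k * n) := by
  induction q with
  | zero => simp
  | succ q ih =>
    rw [Nat.succ_mul, Finset.sum_range_add, ih, ← Finset.sum_add_distrib]
    refine Finset.sum_congr rfl fun j _ => ?_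
    rw [Finset.sum_range_succ, add_comm j (q * n)]

/-- Exponential moments of a sum of increments that are known after a delay of `n` steps. -/
lemma lintegral_exp_sum_le [IsProbabilityMeasure P] (hmono : Monotone 𝓕) (hle : ∀ t, 𝓕 t ≤ mΩ)
    (hn : 0 < n) (hv : 0 ≤ v) (hmeas : ∀ t, Measurable[𝓕 (t + n)] (D t))
    (hD : ∀ t, CondExpMomentBound (𝓕 t) P (D t) v) (r : ℝ) {N q : ℕ} (hN : N ≤ q * n) :
    ∫⁻ ω, ENNReal.ofReal (Real.exp (r * ∑ t ∈ Finset.range N, D t ω)) ∂P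
      ≤ ENNReal.ofReal (Real.exp (n * (q * n : ℕ) * (v * r ^ 2 / 2))) := by
  have hn' : (0 : ℝ) < n := by exact_mod_cast hn
  -- Padding by zeros makes all n progressions equally long.
  let D' : ℕ → Ω → ℝ := fun t => if t < N then D t else fun _ => 0
  have hmeas' : ∀ t, Measurable[𝓕 (t + n)] (D' t) := by
    intro t
    by_cases h : t < N
    · simpa only [D', if_pos h] using hmeas t
    · simp only [D', if_neg h]; exact measurable_const
  have hD' : ∀ t, CondExpMomentBound (𝓕 t) P (D' t) v := by
    intro t
    by_cases h : t < N
    · simpa only [D', if_pos h] using hD t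
    · simp only [D', if_neg h]; exact condExpMomentBound_zero hv
  have hsum : ∀ ω, ∑ t ∈ Finset.range N, D t ω
      = ∑ j ∈ Finset.range n, ∑ k ∈ Finset.range q, D' (j + k * n) ω := by
    intro ω
    rw [← sum_range_mul_eq_sum_progressions (fun t => D' t ω),
      ← Finset.sum_subset (Finset.range_mono hN)]
    · exact Finset.sum_congr rfl fun t ht => by simp only [D', if_pos (Finset.mem_range.1 ht)]
    · intro t _ ht
      simp only [D', if_neg (fun h => ht (Finset.mem_range.2 h))]
  -- Convexity of exp over the n residue classes separates them without independence; the price is r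
  -- replaced by nr.
  have hjensen : ∀ ω, Real.exp (r * ∑ t ∈ Finset.range N, D t ω)
      ≤ ∑ j ∈ Finset.range n, (1 / (n : ℝ)) *
          Real.exp ((n * r) * ∑ k ∈ Finset.range q, D' (j + k * n) ω) := by
    intro ω
    have h := convexOn_exp.map_sum_le (t := Finset.range n) (w := fun _ => 1 / (n : ℝ))
      (p := fun j => (n * r) * ∑ k ∈ Finset.range q, D' (j + k * n) ω)
      (fun _ _ => by positivity) (by simp [hn'.ne']) (fun _ _ => Set.mem_univ _)
    simp only [smul_eq_mul] at h
    refine le_trans (le_of_eq ?_) h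
    rw [hsum, Finset.mul_sum]
    congr 1
    refine Finset.sum_congr rfl fun j _ => ?_
    field_simp
  have hm : ∀ j, Measurable fun ω => ENNReal.ofReal
      (Real.exp ((n * r) * ∑ k ∈ Finset.range q, D' (j + k * n) ω)) := fun j =>
    ((Finset.measurable_sum _ fun k _ => (hmeas' _).mono (hle _) le_rfl).const_mul
      _).exp.ennreal_ofReal
  calc _ ≤ ∫⁻ ω, ∑ j ∈ Finset.range n, ENNReal.ofReal (1 / n) * ENNReal.ofReal
          (Real.exp ((n * r) * ∑ k ∈ Finset.range q, D' (j + k * n) ω)) ∂P := by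
        refine lintegral_mono fun ω => ?_
        refine (ENNReal.ofReal_le_ofReal (hjensen ω)).trans (le_of_eq ?_)
        rw [ENNReal.ofReal_sum_of_nonneg fun j _ => by positivity]
        exact Finset.sum_congr rfl fun j _ => ENNReal.ofReal_mul (by positivity)
    _ = ∑ j ∈ Finset.range n, ENNReal.ofReal (1 / n) * ∫⁻ ω, ENNReal.ofReal
          (Real.exp ((n * r) * ∑ k ∈ Finset.range q, D' (j + k * n) ω)) ∂P := by
        rw [lintegral_finsetSum _ fun j _ => (hm j).const_mul _]
        exact Finset.sum_congr rfl fun j _ => lintegral_const_mul _ (hm j)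
    _ ≤ ∑ _j ∈ Finset.range n, ENNReal.ofReal (1 / n) *
          ENNReal.ofReal (Real.exp (q * (v * (n * r) ^ 2 / 2))) := by
        refine Finset.sum_le_sum fun j _ => ?_
        gcongr
        exact lintegral_exp_progression_le hmono hmeas' hD' (n * r) j q
    _ = _ := by
        rw [Finset.sum_const, Finset.card_range, nsmul_eq_mul, ← mul_assoc,
          ← ENNReal.ofReal_natCast, ← ENNReal.ofReal_mul hn'.le, mul_one_div_cancel hn'.ne',
          ENNReal.ofReal_one, one_mul]
        congr 2; push_cast; ring

/-- Azuma–Hoeffding inequality for increments that are known after a delay of `n` steps. -/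
lemma measureReal_le_sum_le [IsProbabilityMeasure P] (hmono : Monotone 𝓕) (hle : ∀ t, 𝓕 t ≤ mΩ)
    (hn : 0 < n) (hv : 0 < v) (hmeas : ∀ t, Measurable[𝓕 (t + n)] (D t))
    (hD : ∀ t, CondExpMomentBound (𝓕 t) P (D t) v) {N q T : ℕ} (hN : N ≤ q * n) (hT : q * n ≤ T)
    (hT0 : 0 < T) {γ : ℝ} (hγ : 0 ≤ γ) :
    P.real {ω | γ ≤ ∑ t ∈ Finset.range N, D t ω} ≤ Real.exp (-(γ ^ 2 / (2 * n * T * v))) := by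
  have hn' : (0 : ℝ) < n := by exact_mod_cast hn
  have hT' : (0 : ℝ) < T := by exact_mod_cast hT0
  -- This r minimizes nTvr²/2 − rγ.
  set r : ℝ := γ / (n * T * v) with hr
  have hr0 : 0 ≤ r := by positivity
  have hm : Measurable fun ω => ENNReal.ofReal (Real.exp (r * ∑ t ∈ Finset.range N, D t ω)) :=
    ((Finset.measurable_sum _ fun t _ => (hmeas t).mono (hle _) le_rfl).const_mul
      _).exp.ennreal_ofReal
  have h1 := meas_ge_le_lintegral_div (μ := P) hm.aemeasurable
    (ε := ENNReal.ofReal (Real.exp (r * γ))) (by simp [Real.exp_pos]) ENNReal.ofReal_ne_top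
  have h2 := lintegral_exp_sum_le hmono hle hn hv.le hmeas hD r hN
  have h3 : P {ω | γ ≤ ∑ t ∈ Finset.range N, D t ω}
      ≤ ENNReal.ofReal (Real.exp (-(γ ^ 2 / (2 * n * T * v)))) := by
    refine (measure_mono fun ω hω => ?_).trans (h1.trans
      ((ENNReal.div_le_div_right h2 _).trans ?_))
    · exact ENNReal.ofReal_le_ofReal (Real.exp_le_exp.2 (mul_le_mul_of_nonneg_left hω hr0))
    · rw [← ENNReal.ofReal_div_of_pos (Real.exp_pos _), ← Real.exp_sub]
      refine ENNReal.ofReal_le_ofReal (Real.exp_le_exp.2 ?_)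
      have h4 : (n : ℝ) * (q * n : ℕ) * (v * r ^ 2 / 2) ≤ n * T * (v * r ^ 2 / 2) := by
        gcongr
      have h5 : (n : ℝ) * T * (v * r ^ 2 / 2) - r * γ = -(γ ^ 2 / (2 * n * T * v)) := by
        rw [hr]; field_simp; ring
      linarith
  exact ENNReal.toReal_le_of_le_ofReal (Real.exp_pos _).le h3

end Concentration

/-! ### Consequences of total variation mixing. -/

section MixingBounds

variable {Z : Type*} [MeasurableSpace Z]

/-- Expectations of a bounded function differ by at most the total variation distance. -/
lemma abs_integral_sub_le_tvDist (P Q : Measure Z) [IsProbabilityMeasure P]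
    [IsProbabilityMeasure Q] {φ : Z → ℝ} (hφ : Measurable φ) {c : ℝ}
    (hc : ∀ z, φ z ∈ Set.Icc (-c) c) : |∫ z, φ z ∂P - ∫ z, φ z ∂Q| ≤ c * tvDist P Q := by
  have hP : P ≪ P + Q := Measure.absolutelyContinuous_of_le (Measure.le_add_right le_rfl)
  have hQ : Q ≪ P + Q := Measure.absolutelyContinuous_of_le (Measure.le_add_left le_rfl)
  have hb : ∀ z, ‖φ z‖ ≤ c := fun z => abs_le.2 (hc z)
  have hiP : Integrable (fun z => (P.rnDeriv (P + Q) z).toReal) (P + Q) :=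
    Measure.integrable_toReal_rnDeriv
  have hiQ : Integrable (fun z => (Q.rnDeriv (P + Q) z).toReal) (P + Q) :=
    Measure.integrable_toReal_rnDeriv
  have h1 := hiP.mul_bdd hφ.aestronglyMeasurable (Filter.Eventually.of_forall hb)
  have h2 := hiQ.mul_bdd hφ.aestronglyMeasurable (Filter.Eventually.of_forall hb)
  rw [← integral_toReal_rnDeriv_mul hP, ← integral_toReal_rnDeriv_mul hQ, ← integral_sub h1 h2]
  unfold tvDist
  rw [← integral_const_mul]
  refine (abs_integral_le_integral_abs).trans
    (integral_mono (h1.sub h2).abs ((hiP.sub hiQ).abs.const_mul c) fun z => ?_)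
  simp only
  rw [← sub_mul, abs_mul, mul_comm]
  exact mul_le_mul_of_nonneg_right (hb z) (abs_nonneg _)

variable {Ω : Type*} [MeasurableSpace Ω] [StandardBorelSpace Z] [Nonempty Z] {P : Measure Ω}
  [IsProbabilityMeasure P] {ξ : ℕ → Ω → Z} {stat : Measure Z} {tmix : ℝ → ℝ} {Γ ε : ℝ}

lemma one_le_mixingTime (s : ℕ) (ω : Ω) : ((1 : ℝ) : EReal) ≤ mixingTime P ξ stat s ε ω := by
  refine le_sInf ?_
  rintro r ⟨n, hn, -, rfl⟩
  exact_mod_cast hn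

/-- Admissible lags are integers, so one lying strictly below n + 1 is at most n. -/
lemma tvDist_condLaw_le_of_mixingTime_lt {s n : ℕ} {ω : Ω} {θ : ℝ} (hθ : θ ≤ n + 1)
    (h : mixingTime P ξ stat s ε ω < θ) : tvDist (condLaw P ξ s (s + n) ω) stat ≤ ε := by
  obtain ⟨r, ⟨k, -, hk, rfl⟩, hlt⟩ := sInf_lt_iff.1 h
  have h1 : (k : ℝ) < n + 1 := (EReal.coe_lt_coe_iff.1 hlt).trans_le hθ
  exact hk n (Nat.lt_succ_iff.1 (by exact_mod_cast h1))

namespace StochasticallyUniformMixing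

lemma prob_not_mixed_le (h : StochasticallyUniformMixing P ξ stat tmix Γ) (hε : 0 < ε) {c : ℝ}
    (s : ℕ) {n : ℕ} (hc : tmix ε + Γ * c ≤ n + 1) :
    P.real {ω | ¬ tvDist (condLaw P ξ s (s + n) ω) stat ≤ ε} ≤ Real.exp (-c) := by
  refine (measureReal_mono fun ω hω => ?_).trans (h.tail ε hε s c)
  by_contra hlt
  exact hω (tvDist_condLaw_le_of_mixingTime_lt hc (not_le.1 hlt))

/-- Mixing times are at least 1, so a threshold at most 1 would make the tail event certain, against
the bound e^{-c} < 1. -/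
lemma one_lt_of_pos (h : StochasticallyUniformMixing P ξ stat tmix Γ) (hε : 0 < ε) {c : ℝ}
    (hc : 0 < c) : 1 < tmix ε + Γ * c := by
  by_contra! hle
  have h1 := h.tail ε hε 0 c
  have h2 : {ω | ((tmix ε + Γ * c : ℝ) : EReal) ≤ mixingTime P ξ stat 0 ε ω} = Set.univ :=
    Set.eq_univ_of_forall fun ω => (EReal.coe_le_coe_iff.2 hle).trans (one_le_mixingTime 0 ω)
  rw [h2, probReal_univ] at h1
  have h3 : Real.exp (-c) < 1 := by
    rw [← Real.exp_zero]; exact Real.exp_lt_exp.2 (by linarith)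
  linarith

/-- With Γ negative, a large c would push the threshold below 1. -/
lemma constant_nonneg (h : StochasticallyUniformMixing P ξ stat tmix Γ) : 0 ≤ Γ := by
  by_contra! hΓ
  have h1 := h.one_lt_of_pos one_pos (c := (|tmix 1| + 1) / (-Γ)) (by
    have : 0 < -Γ := by linarith
    positivity)
  have h2 : Γ * ((|tmix 1| + 1) / (-Γ)) = -(|tmix 1| + 1) := by
    have := hΓ.ne
    field_simp
  have := le_abs_self (tmix 1)
  linarith

/-- Let c decrease to 0 in `one_lt_of_pos`. -/
lemma one_le_tmix (h : StochasticallyUniformMixing P ξ stat tmix Γ) (hε : 0 < ε) :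
    1 ≤ tmix ε := by
  rcases h.constant_nonneg.eq_or_lt with hΓ | hΓ
  · have := h.one_lt_of_pos hε one_pos
    rw [← hΓ] at this
    linarith
  · refine le_of_forall_pos_le_add fun η hη => ?_
    have := h.one_lt_of_pos hε (c := η / Γ) (by positivity)
    rw [mul_div_cancel₀ _ hΓ.ne'] at this
    exact this.le

variable {T : ℕ} {δ : ℝ}

lemma log_two_le_log_add (hT : 1 ≤ T) (hδ : δ ∈ Set.Ioo (0 : ℝ) 1) :
    Real.log 2 ≤ Real.log (2 / δ) + 2 * Real.log T := by
  have h1 : Real.log 2 ≤ Real.log (2 / δ) := by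
    apply Real.log_le_log (by norm_num)
    rw [le_div_iff₀ hδ.1]
    linarith [hδ.2]
  have h2 : 0 ≤ Real.log T := Real.log_nonneg (by exact_mod_cast hT)
  linarith

lemma one_lt_tau (h : StochasticallyUniformMixing P ξ stat tmix Γ) (hε : 0 < ε) (hT : 1 ≤ T)
    (hδ : δ ∈ Set.Ioo (0 : ℝ) 1) : 1 < tau tmix Γ T ε δ :=
  h.one_lt_of_pos hε ((Real.log_pos (by norm_num)).trans_le (log_two_le_log_add hT hδ))

lemma exp_neg_log_add (hT : 1 ≤ T) (hδ : δ ∈ Set.Ioo (0 : ℝ) 1) :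
    Real.exp (-(Real.log (2 / δ) + 2 * Real.log T)) = δ / (2 * T ^ 2) := by
  have hT' : (0 : ℝ) < T := by exact_mod_cast hT
  have hδ0 := hδ.1
  rw [Real.exp_neg, Real.exp_add, Real.exp_log (by positivity), two_mul, Real.exp_add,
    Real.exp_log hT']
  field_simp

/-- The probability that the process fails to mix within `n` steps, for a lag `n` with
`τ ≤ n + 1`, leaves room for a further failure probability of order `δ`. -/
lemma exists_prob_not_mixed_le (h : StochasticallyUniformMixing P ξ stat tmix Γ) (hε : 0 < ε)
    (hT : 1 ≤ T) (hδ : δ ∈ Set.Ioo (0 : ℝ) 1) {n : ℕ} (hn : 1 ≤ n)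
    (hτ : tau tmix Γ T ε δ ≤ n + 1) :
    ∃ q : ℝ, 0 ≤ q ∧
      (∀ s, P.real {ω | ¬ tvDist (condLaw P ξ s (s + n) ω) stat ≤ ε} ≤ q) ∧
      T * q + δ / tau tmix Γ T ε δ ^ 4 ≤ δ := by
  have hT1 : (1 : ℝ) ≤ T := by exact_mod_cast hT
  have hδ0 := hδ.1
  have hn1 : (1 : ℝ) ≤ n := by exact_mod_cast hn
  have hlog := log_two_le_log_add hT hδ
  have hlog2 := Real.log_two_gt_d9
  have hexp := exp_neg_log_add hT hδ
  have hτ1 := h.one_lt_tau hε hT hδ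
  have hm1 := h.one_le_tmix hε
  have hτdef : tau tmix Γ T ε δ = tmix ε + Γ * (Real.log (2 / δ) + 2 * Real.log T) := rfl
  set C := Real.log (2 / δ) + 2 * Real.log T with hC
  set τ := tau tmix Γ T ε δ with hτ'
  have hhalf : T * (δ / (2 * T ^ 2)) ≤ δ / 2 := by
    have h1 : T * (δ / (2 * (T : ℝ) ^ 2)) = δ / 2 / T := by field_simp
    rw [h1]
    exact div_le_self (by positivity) hT1
  -- For τ^4 ≥ 2 each kind of failure takes at most δ/2.
  rcases le_or_gt 2 (τ ^ 4) with h4 | h4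
  · refine ⟨δ / (2 * T ^ 2), by positivity, fun s => ?_, ?_⟩
    · rw [← hexp]
      exact h.prob_not_mixed_le hε s hτ
    · have : δ / τ ^ 4 ≤ δ / 2 := by gcongr
      linarith
  · have hτ2 : τ < 1.2 := by
      by_contra! hge
      have : (1.2 : ℝ) ^ 4 ≤ τ ^ 4 := by gcongr
      norm_num at this
      linarith
    -- For τ near 1 the deviations may use almost all of δ, so the tail bound needs a larger c. If Γ
    -- = 0, every c is available and q is the room left.
    rcases h.constant_nonneg.eq_or_lt with hΓ | hΓ
    · have hpos : 0 < δ * (1 - 1 / τ ^ 4) / T := by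
        have : 1 / τ ^ 4 < 1 := by
          rw [div_lt_one (by positivity)]
          exact one_lt_pow₀ hτ1 (by norm_num)
        have : 0 < 1 - 1 / τ ^ 4 := by linarith
        positivity
      refine ⟨δ * (1 - 1 / τ ^ 4) / T, hpos.le, fun s => ?_, ?_⟩
      · have := h.prob_not_mixed_le hε (c := -Real.log (δ * (1 - 1 / τ ^ 4) / T)) s (n := n) (by
          rw [← hΓ] at hτdef ⊢
          linarith)
        rwa [neg_neg, Real.exp_log hpos] at this
      · rw [mul_div_cancel₀ _ (by positivity)]
        exact le_of_eq (by ring)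
    -- Since n + 1 ≥ 2, the tail may be taken at threshold 2, which raises c above C by (2 − τ)/Γ.
    -- The extra factor is at most 2(τ − 1), as 0.69Γ ≤ ΓC ≤ τ − 1. Non-mixing then takes at most
    -- δ(τ − 1) and the deviations at most δ(2 − τ).
    · refine ⟨Real.exp (-((2 - tmix ε) / Γ)), (Real.exp_pos _).le, fun s => ?_, ?_⟩
      · refine h.prob_not_mixed_le hε s ?_
        rw [mul_div_cancel₀ _ hΓ.ne']
        linarith
      · have h5 : -((2 - tmix ε) / Γ) = -C + -((2 - τ) / Γ) := by
          rw [hτdef]; field_simp; ring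
        have hy : 0 < (2 - τ) / Γ := div_pos (by linarith) hΓ
        have h6 : Real.exp (-((2 - τ) / Γ)) ≤ 2 * (τ - 1) := by
          have h7 : (2 - τ) / Γ ≤ Real.exp ((2 - τ) / Γ) := by
            linarith [Real.add_one_le_exp ((2 - τ) / Γ)]
          rw [Real.exp_neg]
          calc (Real.exp ((2 - τ) / Γ))⁻¹ ≤ ((2 - τ) / Γ)⁻¹ := by gcongr
            _ = Γ / (2 - τ) := inv_div _ _
            _ ≤ 2 * (τ - 1) := by
              rw [div_le_iff₀ (by linarith)]
              have h8 : Γ * 0.69 ≤ Γ * C := by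
                gcongr
                norm_num at hlog2 ⊢
                linarith
              nlinarith
        rw [h5, Real.exp_add, hexp, ← mul_assoc]
        have h9 : T * (δ / (2 * T ^ 2)) * Real.exp (-((2 - τ) / Γ))
            ≤ δ / 2 * (2 * (τ - 1)) := by gcongr
        have h10 : δ / τ ^ 4 ≤ δ * (2 - τ) := by
          rw [div_le_iff₀ (by positivity), mul_assoc]
          have h11 : 1 ≤ (2 - τ) * τ ^ 2 := by nlinarith [mul_pos (sub_pos.2 hτ1) (sub_pos.2 hτ1)]
          have h12 : (2 - τ) * τ ^ 2 ≤ (2 - τ) * τ ^ 4 := by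
            have : 0 ≤ 2 - τ := by linarith
            gcongr
            · exact hτ1.le
            · norm_num
          nlinarith
        linarith

end StochasticallyUniformMixing

end MixingBounds

/-! ### Truncated gaps. -/

section Truncation

variable {E Z : Type*} {F : E → Z → ℝ}

/-- The gap `F(x; z) - F(u; z)`, truncated to `[-c, c]`. -/
def truncatedGap (F : E → Z → ℝ) (u : E) (c : ℝ) (x : E) (z : Z) : ℝ :=
  max (-c) (min c (F x z - F u z))

/-- The Lipschitz bound is only almost sure, whereas the Hoeffding and total variation estimates
need boundedness at every point; truncation supplies it. -/
lemma truncatedGap_mem {c : ℝ} (hc : 0 ≤ c) (u x : E) (z : Z) :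
    truncatedGap F u c x z ∈ Set.Icc (-c) c :=
  ⟨le_max_left _ _, max_le (by linarith) (min_le_left _ _)⟩

lemma truncatedGap_eq {c : ℝ} {u x : E} {z : Z} (h : |F x z - F u z| ≤ c) :
    truncatedGap F u c x z = F x z - F u z := by
  rw [truncatedGap, min_eq_right (abs_le.1 h).2, max_eq_right (abs_le.1 h).1]

lemma measurable_truncatedGap [MeasurableSpace E] [MeasurableSpace Z]
    (hF : Measurable (Function.uncurry F)) (u : E) (c : ℝ) : Measurable (Function.uncurry (truncatedGap F u c)) := by
  have h1 : Measurable fun p : E × Z => F u p.2 :=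
    (hF.comp measurable_prodMk_left).comp measurable_snd
  exact measurable_const.max (measurable_const.min (hF.sub h1))

end Truncation

/-! ### The expected objective and the averaged iterate. -/

section Objective

variable {E : Type*} [NormedAddCommGroup E] {Z : Type*} [MeasurableSpace Z]
  {stat : Measure Z} {X : Set E} {F : E → Z → ℝ} {L : ℝ}

lemma lipschitzOver_objective [IsProbabilityMeasure stat]
    (hint : ∀ x ∈ X, Integrable (F x) stat)
    (hLip : ∀ᵐ z ∂stat, LipschitzOver X L (fun x => F x z)) :
    LipschitzOver X L (objective F stat) := by
  intro x hx y hy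
  unfold objective
  rw [← integral_sub (hint x hx) (hint y hy)]
  have h := norm_integral_le_of_norm_le_const (μ := stat) (f := fun z => F x z - F y z)
    (C := L * ‖x - y‖) (hLip.mono fun z hz => hz x hx y hy)
  simpa using h

lemma LipschitzOver.continuousOn {f : E → ℝ} (hL : 0 ≤ L) (hf : LipschitzOver X L f) :
    ContinuousOn f X :=
  (LipschitzOnWith.of_dist_le_mul (K := ⟨L, hL⟩) fun x hx y hy => by
    rw [Real.dist_eq, dist_eq_norm]; exact hf x hx y hy).continuousOn

variable [NormedSpace ℝ E]

lemma convexOn_objective (hX : Convex ℝ X) (hF : ∀ z, ConvexOn ℝ X fun x => F x z)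
    (hint : ∀ x ∈ X, Integrable (F x) stat) : ConvexOn ℝ X (objective F stat) := by
  refine ⟨hX, fun x hx y hy a b ha hb hab => ?_⟩
  have h1 := (hint x hx).const_mul a
  have h2 := (hint y hy).const_mul b
  simp only [objective, smul_eq_mul]
  rw [← integral_const_mul, ← integral_const_mul, ← integral_add h1 h2]
  exact integral_mono (hint _ (hX hx hy ha hb hab)) (h1.add h2)
    fun z => (hF z).2 hx hy ha hb hab

lemma sum_Icc_one_eq_sum_range {M : Type*} [AddCommMonoid M] (h : ℕ → M) (T : ℕ) :
    ∑ t ∈ Finset.Icc 1 T, h t = ∑ t ∈ Finset.range T, h (t + 1) := by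
  induction T with
  | zero => simp
  | succ T ih => rw [Finset.sum_Icc_succ_top (by omega), Finset.sum_range_succ, ih]

variable {Ω : Type*} {x : ℕ → Ω → E} {T : ℕ} {ω : Ω}

lemma average_eq_sum_range (x : ℕ → Ω → E) (T : ℕ) (ω : Ω) :
    average x T ω = ∑ t ∈ Finset.range T, (1 / (T : ℝ)) • x (t + 1) ω := by
  rw [average, sum_Icc_one_eq_sum_range, Finset.smul_sum]

lemma average_mem (hX : Convex ℝ X) (hT : 1 ≤ T) (hx : ∀ t, x (t + 1) ω ∈ X) :
    average x T ω ∈ X := by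
  have hT' : (T : ℝ) ≠ 0 := by positivity
  rw [average_eq_sum_range]
  exact hX.sum_mem (fun _ _ => by positivity) (by simp [hT']) fun t _ => hx t

lemma gap_average_le {f : E → ℝ} (hf : ConvexOn ℝ X f) (hT : 1 ≤ T)
    (hx : ∀ t, x (t + 1) ω ∈ X) (u : E) :
    f (average x T ω) - f u ≤ 1 / (T : ℝ) * ∑ t ∈ Finset.range T, (f (x (t + 1) ω) - f u) := by
  have hT' : (T : ℝ) ≠ 0 := by positivity
  have h := hf.map_sum_le (t := Finset.range T) (w := fun _ => 1 / (T : ℝ))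
    (p := fun t => x (t + 1) ω) (fun _ _ => by positivity) (by simp [hT']) fun t _ => hx t
  rw [← average_eq_sum_range] at h
  simp only [smul_eq_mul, ← Finset.mul_sum] at h
  rw [Finset.sum_sub_distrib, mul_sub, Finset.sum_const, Finset.card_range, nsmul_eq_mul,
    one_div, inv_mul_cancel_left₀ hT']
  rw [one_div] at h
  linarith

lemma le_rateBound {R : ℝ} {α : ℕ → ℝ} {ε δ τ m : ℝ} (hT : 1 ≤ T) (hL : 0 ≤ L) (hR : 0 ≤ R)
    (hα : ∀ t, 1 ≤ t → 0 < α t) (hm : m + 1 ≤ τ) :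
    1 / (T : ℝ) * (T * (ε * (L * R)) + T * (4 * (L * R) * Real.sqrt (τ * Real.log (τ / δ) / T))
      + m * (L ^ 2 * ∑ t ∈ Finset.range T, α (t + 1) + L * R) + R ^ 2 / (2 * α T)
      + L ^ 2 / 2 * ∑ t ∈ Finset.range T, α (t + 1)) ≤ rateBound R L α T ε δ τ := by
  have hT' : (0 : ℝ) < T := by exact_mod_cast hT
  have hα' := hα T hT
  have hS : 0 ≤ ∑ t ∈ Finset.range T, α (t + 1) :=
    Finset.sum_nonneg fun t _ => (hα _ (by omega)).le
  rw [rateBound, sum_Icc_one_eq_sum_range]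
  set S := ∑ t ∈ Finset.range T, α (t + 1)
  set r := Real.sqrt (τ * Real.log (τ / δ) / T)
  have h1 : m / T * (L ^ 2 * S + L * R) ≤ (τ - 1) / T * (L ^ 2 * S + L * R) := by
    gcongr; linarith
  have h2 : 1 / (T : ℝ) * (T * (ε * (L * R)) + T * (4 * (L * R) * r) + m * (L ^ 2 * S + L * R)
      + R ^ 2 / (2 * α T) + L ^ 2 / 2 * S)
      = R ^ 2 / (2 * T * α T) + L ^ 2 / (2 * T) * S + m / T * (L ^ 2 * S + L * R)
        + ε * L * R + 4 * L * R * r := by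
    field_simp
    ring
  rw [h2]
  linarith

end Objective

/-- The exponent equals 8(τ/n)log(τ/δ). Since n ≤ τ, half of it already gives (δ/τ)^4. -/
lemma exp_neg_deviation_le {T n : ℕ} {c δ τ : ℝ} (hT : 1 ≤ T) (hn : 1 ≤ n) (hnτ : (n : ℝ) ≤ τ)
    (hc : 0 < c) (hτ : 1 < τ) (hδ : δ ∈ Set.Ioo (0 : ℝ) 1) :
    Real.exp (-((T * (4 * c * Real.sqrt (τ * Real.log (τ / δ) / T))) ^ 2
      / (2 * n * T * c ^ 2))) ≤ δ / τ ^ 4 := by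
  have hT' : (0 : ℝ) < T := by exact_mod_cast hT
  have hn' : (0 : ℝ) < n := by exact_mod_cast hn
  have hδ0 := hδ.1
  have hτ0 : 0 < τ := by linarith
  have hlog : 0 ≤ Real.log (τ / δ) := by
    apply Real.log_nonneg
    rw [le_div_iff₀ hδ0]
    linarith [hδ.2]
  have h1 : (T * (4 * c * Real.sqrt (τ * Real.log (τ / δ) / T))) ^ 2 / (2 * n * T * c ^ 2)
      = 8 * (τ / n * Real.log (τ / δ)) := by
    rw [mul_pow, mul_pow, Real.sq_sqrt (by positivity)]
    field_simp
    ring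
  have h2 : Real.log (τ / δ) ≤ τ / n * Real.log (τ / δ) :=
    le_mul_of_one_le_left hlog (by rwa [one_le_div hn'])
  rw [h1]
  calc _ ≤ Real.exp (-((4 : ℕ) * Real.log (τ / δ))) := by
        apply Real.exp_le_exp.2
        push_cast
        linarith
    _ = δ ^ 4 / τ ^ 4 := by
        rw [Real.exp_neg, Real.exp_nat_mul, Real.exp_log (by positivity), div_pow, inv_div]
    _ ≤ δ / τ ^ 4 := by
        gcongr
        exact pow_le_of_le_one hδ0.le hδ.2.le (by norm_num)

/-! ### The bound for fixed accuracy and comparison point. -/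

section HighProbability

variable {E : Type*} [NormedAddCommGroup E] [NormedSpace ℝ E]
  [MeasurableSpace E]
  {Z : Type*} [MeasurableSpace Z] [StandardBorelSpace Z] [Nonempty Z]
  {Ω : Type*} [MeasurableSpace Ω] {P : Measure Ω} [IsProbabilityMeasure P]

/-- The deviation of a truncated gap from its conditional expectation given the first `t`
samples. -/
def gapDeviation (P : Measure Ω) [IsProbabilityMeasure P] (ξ : ℕ → Ω → Z) (φ : E → Z → ℝ)
    (x : ℕ → Ω → E) (n t : ℕ) (ω : Ω) : ℝ :=
  ∫ z, φ (x (t + 1) ω) z ∂(condLaw P ξ t (t + n) ω) - φ (x (t + 1) ω) (ξ (t + n) ω)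

variable {ξ : ℕ → Ω → Z} {φ : E → Z → ℝ} {x : ℕ → Ω → E} {n : ℕ} {c : ℝ}

variable {stat : Measure Z} [IsProbabilityMeasure stat] {X : Set E} {F : E → Z → ℝ}
  {G : E → Z → E →L[ℝ] ℝ} {L R : ℝ} {ψ : E → ℝ} {α : ℕ → ℝ} {x₁ u : E}
  {tmix : ℝ → ℝ} {Γ ε δ : ℝ} {T : ℕ}

/-- The optimality gap at the averaged iterate, on the event where the process mixes within
`m + 1` steps and the martingale deviations are small. -/
lemma gap_average_le_of_mixed (hXconv : Convex ℝ X) (hFconv : ∀ z, ConvexOn ℝ X (fun x => F x z))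
    (hFmeas : Measurable (Function.uncurry F)) (hFint : ∀ x ∈ X, Integrable (F x) stat)
    (hG : ∀ z, ∀ x ∈ X, IsSubgradient X (fun y => F y z) x (G x z)) (hL : 0 ≤ L)
    (hLip_stat : ∀ᵐ z ∂stat, LipschitzOver X L (fun x => F x z))
    (hψ : IsProx ψ X) (hR : 0 ≤ R) (hrad : ∀ x ∈ X, ∀ y ∈ X, bregman ψ X x y ≤ (1 / 2) * R ^ 2)
    (hα : ∀ t, 1 ≤ t → 0 < α t) (hα_anti : AntitoneOn α (Set.Ici 1))
    (hx : IsErgodicMirrorDescent X ψ G α ξ x₁ x) (hu : u ∈ X) (hε : 0 < ε) {ω : Ω}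
    (m N : ℕ) {γ : ℝ}
    (hLip : ∀ t, 1 ≤ t → LipschitzOver X L (fun x => F x (ξ t ω)))
    (hGL : ∀ t, 1 ≤ t → ∀ x ∈ X, ‖G x (ξ t ω)‖ ≤ L)
    (htv : ∀ t < N + 1, tvDist (condLaw P ξ t (t + (m + 1)) ω) stat ≤ ε)
    (hdev : ∑ t ∈ Finset.range (N + 1),
      gapDeviation P ξ (truncatedGap F u (L * R)) x (m + 1) t ω ≤ γ) :
    objective F stat (average x (m + (N + 1)) ω) - objective F stat u
      ≤ 1 / ((m + (N + 1) : ℕ) : ℝ) * (((m + (N + 1) : ℕ) : ℝ) * (ε * (L * R)) + γ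
        + m * (L ^ 2 * ∑ t ∈ Finset.range (m + (N + 1)), α (t + 1) + L * R)
        + R ^ 2 / (2 * α (m + (N + 1)))
        + L ^ 2 / 2 * ∑ t ∈ Finset.range (m + (N + 1)), α (t + 1)) := by
  have hc : 0 ≤ L * R := mul_nonneg hL hR
  have hgap : ∀ t, L * ‖x (t + 1) ω - u‖ ≤ L * R := fun t => by
    gcongr
    exact hψ.norm_sub_le_radius hR hrad (hx.mem_domain t ω) hu
  refine (gap_average_le (convexOn_objective hXconv hFconv hFint) (by omega)
    (fun t => hx.mem_domain t ω) u).trans (mul_le_mul_of_nonneg_left ?_ (by positivity))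
  have hsum := hψ.sum_gap_le hXconv (a := fun t => α (t + 1)) (y := fun t => x (t + 1) ω)
    (g := fun t => G (x (t + 1) ω) (ξ (t + 1) ω)) (fun t => hα _ (by omega))
    (fun s t hst => hα_anti (Set.mem_Ici.2 (by omega)) (Set.mem_Ici.2 (by omega)) (by omega)) hL
    (fun t => hx.mem_domain t ω) (fun t => hx.argmin (t + 1) (by omega) ω) hR hrad hu
    (lipschitzOver_objective hFint hLip_stat) (h := fun t v => F v (ξ (t + 1) ω)) m N
    (fun s _ => hGL _ (by omega) _ (hx.mem_domain s ω)) (fun s _ => hLip _ (by omega))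
    (fun s => hG _ _ (hx.mem_domain s ω))
  have hterm : ∀ t ∈ Finset.range (N + 1),
      (objective F stat (x (t + 1) ω) - objective F stat u)
        - (F (x (t + 1) ω) (ξ (m + t + 1) ω) - F u (ξ (m + t + 1) ω))
      ≤ ε * (L * R) + gapDeviation P ξ (truncatedGap F u (L * R)) x (m + 1) t ω := by
    intro t ht
    have h1 : objective F stat (x (t + 1) ω) - objective F stat u
        = ∫ z, truncatedGap F u (L * R) (x (t + 1) ω) z ∂stat := by
      unfold objective
      rw [← integral_sub (hFint _ (hx.mem_domain t ω)) (hFint _ hu)]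
      refine integral_congr_ae (hLip_stat.mono fun z hz => ?_)
      exact (truncatedGap_eq ((hz _ (hx.mem_domain t ω) _ hu).trans (hgap t))).symm
    have h2 := truncatedGap_eq
      ((hLip (m + t + 1) (by omega) _ (hx.mem_domain t ω) _ hu).trans (hgap t))
    have _ : IsProbabilityMeasure (condLaw P ξ t (t + (m + 1)) ω) := by
      unfold condLaw; infer_instance
    have h3 := abs_integral_sub_le_tvDist (condLaw P ξ t (t + (m + 1)) ω) stat
      ((measurable_truncatedGap hFmeas u (L * R)).comp
        (measurable_prodMk_left (x := x (t + 1) ω)))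
      fun z => truncatedGap_mem hc u _ z
    have h4 := (abs_le.1 (h3.trans
      (mul_le_mul_of_nonneg_left (htv t (Finset.mem_range.1 ht)) hc))).1
    -- The sample m steps after x(t+1) lies at lag m + 1 from the t samples that determine x(t+1).
    have h5 : m + t + 1 = t + (m + 1) := by omega
    simp only [Function.comp_def, Function.uncurry_apply_pair] at h4
    rw [h1, ← h2, gapDeviation, h5]
    linarith
  have hsum2 := Finset.sum_le_sum hterm
  rw [Finset.sum_add_distrib, Finset.sum_const, Finset.card_range, nsmul_eq_mul] at hsum2
  have hN : ((N + 1 : ℕ) : ℝ) * (ε * (L * R)) ≤ ((m + (N + 1) : ℕ) : ℝ) * (ε * (L * R)) := by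
    exact mul_le_mul_of_nonneg_right (Nat.cast_le.2 (by omega)) (by positivity)
  have hidx : m + N + 1 = m + (N + 1) := by omega
  rw [hidx] at hsum
  linarith

variable [FiniteDimensional ℝ E] [BorelSpace E]

lemma measurable_gapDeviation (hφ : Measurable (Function.uncurry φ))
    (hx : ∀ t, Measurable[MeasurableSpace.comap (past ξ t) inferInstance] (x (t + 1)))
    (hn : 1 ≤ n) (t : ℕ) :
    Measurable[MeasurableSpace.comap (past ξ (t + n)) inferInstance]
      (gapDeviation P ξ φ x n t) := by
  obtain ⟨y, hy, hxy⟩ := (hx t).exists_eq_measurable_comp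
  have hint : Measurable fun a => ∫ z, φ (y a) z ∂(condDistrib (ξ (t + n)) (past ξ t) P a) :=
    (StronglyMeasurable.integral_condDistrib (Y := ξ (t + n)) (X := past ξ t) (μ := P)
      (f := fun p : _ × Z => φ (y p.1) p.2)
      (hφ.comp ((hy.comp measurable_fst).prodMk measurable_snd)).stronglyMeasurable).measurable
  have hle := comap_past_mono ξ (Nat.le_add_right t n)
  have h1 : Measurable[MeasurableSpace.comap (past ξ (t + n)) inferInstance]
      fun ω => ∫ z, φ (x (t + 1) ω) z ∂(condLaw P ξ t (t + n) ω) := by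
    have : (fun ω => ∫ z, φ (x (t + 1) ω) z ∂(condLaw P ξ t (t + n) ω))
        = (fun a => ∫ z, φ (y a) z ∂(condDistrib (ξ (t + n)) (past ξ t) P a)) ∘ past ξ t := by
      rw [hxy]; rfl
    rw [this]
    exact (hint.comp (comap_measurable (past ξ t))).mono hle le_rfl
  exact h1.sub (hφ.comp (((hx t).mono hle le_rfl).prodMk
    (measurable_sample_past ξ (by omega) le_rfl)))

/-- The iterate factors through the past, so conditioning on the past freezes it. -/
lemma condExpMomentBound_gapDeviation (hξ : ∀ t, Measurable (ξ t))
    (hφ : Measurable (Function.uncurry φ)) (hc : ∀ v z, φ v z ∈ Set.Icc (-c) c)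
    (hx : ∀ t, Measurable[MeasurableSpace.comap (past ξ t) inferInstance] (x (t + 1))) (t : ℕ) :
    CondExpMomentBound (MeasurableSpace.comap (past ξ t) inferInstance) P
      (gapDeviation P ξ φ x n t) (c ^ 2) := by
  obtain ⟨y, hy, hxy⟩ := (hx t).exists_eq_measurable_comp
  have h := condExpMomentBound_of_condDistrib (P := P) (measurable_past hξ t) (hξ (t + n))
    (φ := fun a z => φ (y a) z)
    (hφ.comp ((hy.comp measurable_fst).prodMk measurable_snd)) fun a z => hc _ z
  have : gapDeviation P ξ φ x n t
      = fun ω => ∫ z, φ (y (past ξ t ω)) z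
          ∂(condDistrib (ξ (t + n)) (past ξ t) P (past ξ t ω))
        - φ (y (past ξ t ω)) (ξ (t + n) ω) := by
    funext ω
    simp only [gapDeviation, hxy, condLaw, Function.comp_apply]
  rw [this]
  exact h

/-- The high-probability bound for a fixed accuracy `ε` and a fixed comparison point `u`. -/
lemma prob_rateBound_lt_gap_le (hξ : ∀ t, Measurable (ξ t))
    (hXconv : Convex ℝ X) (hFmeas : Measurable (Function.uncurry F))
    (hFconv : ∀ z, ConvexOn ℝ X (fun x => F x z))
    (hFint : ∀ x ∈ X, Integrable (F x) stat)
    (hGmeas : Measurable (Function.uncurry G))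
    (hG : ∀ z, ∀ x ∈ X, IsSubgradient X (fun y => F y z) x (G x z)) (hL : 0 ≤ L)
    (hLip_stat : ∀ᵐ z ∂stat, LipschitzOver X L (fun x => F x z))
    (hLip_sample : ∀ t, 1 ≤ t → ∀ᵐ ω ∂P, LipschitzOver X L (fun x => F x (ξ t ω)))
    (hG_sample : ∀ t, 1 ≤ t → ∀ᵐ ω ∂P, ∀ x ∈ X, ‖G x (ξ t ω)‖ ≤ L)
    (hψ : IsProx ψ X) (hR : 0 ≤ R) (hrad : ∀ x ∈ X, ∀ y ∈ X, bregman ψ X x y ≤ (1 / 2) * R ^ 2)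
    (hα : ∀ t, 1 ≤ t → 0 < α t) (hα_anti : AntitoneOn α (Set.Ici 1))
    (hx : IsErgodicMirrorDescent X ψ G α ξ x₁ x)
    (hmix : StochasticallyUniformMixing P ξ stat tmix Γ) (hT : 1 ≤ T)
    (hδ : δ ∈ Set.Ioo (0 : ℝ) 1) (hε : 0 < ε) (hu : u ∈ X) :
    P.real {ω | rateBound R L α T ε δ (tau tmix Γ T ε δ)
      < objective F stat (average x T ω) - objective F stat u} ≤ δ := by
  have hT' : (0 : ℝ) < T := by exact_mod_cast hT
  have hc : 0 ≤ L * R := mul_nonneg hL hR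
  have hτ1 := hmix.one_lt_tau hε hT hδ
  -- Take m = ⌈τ⌉ − 2; the natural subtraction is genuine because τ > 1.
  obtain ⟨m, hmτ, hτm⟩ : ∃ m : ℕ, (m : ℝ) + 1 < tau tmix Γ T ε δ ∧
      tau tmix Γ T ε δ ≤ ((m + 1 : ℕ) : ℝ) + 1 := by
    have h1 : 1 < ⌈tau tmix Γ T ε δ⌉₊ := Nat.lt_ceil.2 (by exact_mod_cast hτ1)
    refine ⟨⌈tau tmix Γ T ε δ⌉₊ - 2, ?_, ?_⟩
    · have : ⌈tau tmix Γ T ε δ⌉₊ - 2 + 1 < ⌈tau tmix Γ T ε δ⌉₊ := by omega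
      exact_mod_cast Nat.lt_ceil.1 this
    · have : ⌈tau tmix Γ T ε δ⌉₊ = ⌈tau tmix Γ T ε δ⌉₊ - 2 + 1 + 1 := by omega
      have h2 := Nat.le_ceil (tau tmix Γ T ε δ)
      rw [this] at h2
      exact_mod_cast h2
  set τ := tau tmix Γ T ε δ with hτdef
  have hrate := le_rateBound (ε := ε) (δ := δ) hT hL hR hα hmτ.le
  have hSα : 0 ≤ ∑ t ∈ Finset.range T, α (t + 1) :=
    Finset.sum_nonneg fun t _ => (hα _ (by omega)).le
  have hαT := hα T hT
  -- No iterate has a partner when T ≤ m, and concentration needs LR > 0; in both cases the bound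
  -- already exceeds or equals LR, which dominates the gap.
  by_cases htriv : T ≤ m ∨ L * R = 0
  · have hempty : {ω | rateBound R L α T ε δ τ
        < objective F stat (average x T ω) - objective F stat u} = ∅ := by
      refine Set.eq_empty_of_forall_notMem fun ω hω => ?_
      have hmem : average x T ω ∈ X := average_mem hXconv hT fun t => hx.mem_domain t ω
      have h1 : objective F stat (average x T ω) - objective F stat u ≤ L * R := by
        refine (le_abs_self _).trans
          ((lipschitzOver_objective hFint hLip_stat _ hmem _ hu).trans ?_)
        gcongr
        exact hψ.norm_sub_le_radius hR hrad hmem hu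
      have h2 : L * R ≤ rateBound R L α T ε δ τ := by
        refine le_trans ?_ hrate
        have h3 : T * (L * R) ≤ m * (L * R) := by
          rcases htriv with h | h
          · gcongr
          · simp [h]
        rw [one_div, inv_mul_eq_div, le_div_iff₀ hT', mul_comm (L * R)]
        have h4 : 0 ≤ m * (L ^ 2 * ∑ t ∈ Finset.range T, α (t + 1)) := by positivity
        have h5 : 0 ≤ T * (ε * (L * R)) := by positivity
        have h6 : 0 ≤ T * (4 * (L * R) * Real.sqrt (τ * Real.log (τ / δ) / T)) := by positivity
        have h7 : 0 ≤ R ^ 2 / (2 * α T) := by positivity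
        have h8 : 0 ≤ L ^ 2 / 2 * ∑ t ∈ Finset.range T, α (t + 1) := by positivity
        linarith
      exact absurd (hω.trans_le h1) (not_lt.2 h2)
    rw [hempty, measureReal_empty]
    exact hδ.1.le
  push Not at htriv
  obtain ⟨hmT, hc0⟩ := htriv
  have hcpos : 0 < L * R := lt_of_le_of_ne hc (Ne.symm hc0)
  obtain ⟨N, hN⟩ : ∃ N, T = m + (N + 1) := ⟨T - m - 1, by omega⟩
  obtain ⟨q, hq0, hq, hqδ⟩ := hmix.exists_prob_not_mixed_le hε hT hδ (n := m + 1) (by omega) hτm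
  set γ := T * (4 * (L * R) * Real.sqrt (τ * Real.log (τ / δ) / T)) with hγ
  set D := gapDeviation P ξ (truncatedGap F u (L * R)) x (m + 1) with hD
  have hxm := hx.measurable_past hψ hXconv hGmeas hα
  have hφ := measurable_truncatedGap hFmeas u (L * R)
  have hdev : P.real {ω | γ ≤ ∑ t ∈ Finset.range (N + 1), D t ω} ≤ δ / τ ^ 4 := by
    refine (measureReal_le_sum_le (𝓕 := fun t => MeasurableSpace.comap (past ξ t) inferInstance)
      (n := m + 1) (q := T / (m + 1)) (T := T) (v := (L * R) ^ 2)
      (fun s t hst => comap_past_mono ξ hst)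
      (fun t => (measurable_past hξ t).comap_le) (by omega) (by positivity)
      (measurable_gapDeviation hφ hxm (by omega))
      (condExpMomentBound_gapDeviation hξ hφ (truncatedGap_mem hc u) hxm) ?_
      (Nat.div_mul_le_self _ _) (by omega) (by positivity)).trans
      (exp_neg_deviation_le hT (by omega) (by push_cast; exact hmτ.le) hcpos hτ1 hδ)
    -- The largest multiple of m + 1 not above T is at least T − m = N + 1, so padding to full
    -- progressions stays within T.
    have h1 := Nat.div_add_mod T (m + 1)
    have h2 := Nat.mod_lt T (y := m + 1) (by omega)
    rw [mul_comm] at h1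
    omega
  have hae : ∀ᵐ ω ∂P, ω ∈ {ω | rateBound R L α T ε δ τ
        < objective F stat (average x T ω) - objective F stat u} →
      ω ∈ (⋃ t ∈ Finset.range (N + 1),
          {ω | ¬ tvDist (condLaw P ξ t (t + (m + 1)) ω) stat ≤ ε})
        ∪ {ω | γ ≤ ∑ t ∈ Finset.range (N + 1), D t ω} := by
    have h1 : ∀ᵐ ω ∂P, ∀ t, 1 ≤ t → LipschitzOver X L (fun x => F x (ξ t ω)) :=
      ae_all_iff.2 fun t => Filter.eventually_imp_distrib_left.2 (hLip_sample t)
    have h2 : ∀ᵐ ω ∂P, ∀ t, 1 ≤ t → ∀ x ∈ X, ‖G x (ξ t ω)‖ ≤ L :=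
      ae_all_iff.2 fun t => Filter.eventually_imp_distrib_left.2 (hG_sample t)
    filter_upwards [h1, h2] with ω hω1 hω2 hω
    by_contra hbad
    simp only [Set.mem_union, Set.mem_iUnion, Finset.mem_range, Set.mem_ofPred_eq, exists_prop,
      not_or, not_exists, not_and, not_le] at hbad
    have h3 := gap_average_le_of_mixed (P := P) hXconv hFconv hFmeas hFint hG hL hLip_stat hψ hR
      hrad hα hα_anti hx hu hε m N hω1 hω2
      (fun t ht => not_lt.1 (hbad.1 t ht)) hbad.2.le
    rw [← hN] at h3
    exact absurd (lt_of_lt_of_le hω h3) (not_lt.2 hrate)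
  calc _ ≤ P.real ((⋃ t ∈ Finset.range (N + 1),
          {ω | ¬ tvDist (condLaw P ξ t (t + (m + 1)) ω) stat ≤ ε})
        ∪ {ω | γ ≤ ∑ t ∈ Finset.range (N + 1), D t ω}) :=
        ENNReal.toReal_mono (measure_ne_top _ _) (measure_mono_ae hae)
    _ ≤ P.real (⋃ t ∈ Finset.range (N + 1),
          {ω | ¬ tvDist (condLaw P ξ t (t + (m + 1)) ω) stat ≤ ε})
        + P.real {ω | γ ≤ ∑ t ∈ Finset.range (N + 1), D t ω} := measureReal_union_le _ _
    _ ≤ T * q + δ / τ ^ 4 := by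
        refine add_le_add ((measureReal_biUnion_finset_le _ _).trans
          ((Finset.sum_le_sum fun t _ => hq t).trans ?_)) hdev
        rw [Finset.sum_const, Finset.card_range, nsmul_eq_mul]
        gcongr
        omega
    _ ≤ δ := hqδ

end HighProbability

/-- If a random variable exceeds each of a family of levels with probability at most `δ`, then it
exceeds the infimum of the levels with probability at most `δ`. -/
lemma prob_iInf_lt_le {Ω ι : Type*} [MeasurableSpace Ω] {P : Measure Ω} [IsFiniteMeasure P]
    [Nonempty ι] {b : ι → ℝ} {Y : Ω → ℝ} {δ : ℝ} (hδ : 0 ≤ δ)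
    (h : ∀ i, P.real {ω | b i < Y ω} ≤ δ) :
    P.real {ω | (⨅ i, (b i : EReal)) < (Y ω : EReal)} ≤ δ := by
  -- Along levels decreasing to the infimum the events increase, so continuity from below replaces a
  -- union bound.
  obtain ⟨v, hanti, hlim, hmem⟩ := exists_seq_tendsto_sInf
    (Set.range_nonempty fun i => (b i : EReal)) (OrderBot.bddBelow _)
  have hsub : {ω | (⨅ i, (b i : EReal)) < (Y ω : EReal)} ⊆ ⋃ k, {ω | v k < (Y ω : EReal)} := by
    intro ω hω
    obtain ⟨k, hk⟩ := (hlim.eventually_lt_const hω).exists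
    exact Set.mem_iUnion.2 ⟨k, hk⟩
  have hmono : Monotone fun k => {ω | v k < (Y ω : EReal)} := fun k l hkl ω hω =>
    (hanti hkl).trans_lt hω
  refine ENNReal.toReal_le_of_le_ofReal hδ ((measure_mono hsub).trans ?_)
  rw [hmono.measure_iUnion]
  refine iSup_le fun k => ?_
  obtain ⟨i, hi⟩ := hmem k
  have hset : {ω | v k < (Y ω : EReal)} = {ω | b i < Y ω} := by
    ext ω
    simp only [Set.mem_ofPred_eq, ← hi, EReal.coe_lt_coe_iff]
  rw [hset]
  exact (ENNReal.le_ofReal_iff_toReal_le (measure_ne_top _ _) hδ).2 (h i)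

end EMD

end

theorem theorem3
    {E : Type*} [NormedAddCommGroup E] [NormedSpace ℝ E] [FiniteDimensional ℝ E]
    [MeasurableSpace E] [BorelSpace E]
    {Z : Type*} [MeasurableSpace Z] [StandardBorelSpace Z] [Nonempty Z]
    {Ω : Type*} [MeasurableSpace Ω] (P : Measure Ω) [IsProbabilityMeasure P]
    -- the sample process and its stationary distribution
    (ξ : ℕ → Ω → Z) (hξ : ∀ t, Measurable (ξ t))
    (stat : Measure Z) [IsProbabilityMeasure stat]
    -- the domain and the convex functions with their subgradient selection
    (X : Set E) (hXc : IsCompact X) (hXconv : Convex ℝ X)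
    (F : E → Z → ℝ) (hFmeas : Measurable (Function.uncurry F))
    (hFconv : ∀ z, ConvexOn ℝ X (fun x => F x z))
    (hFint : ∀ x ∈ X, Integrable (F x) stat)
    (G : E → Z → E →L[ℝ] ℝ) (hGmeas : Measurable (Function.uncurry G))
    (hG : ∀ z, ∀ x ∈ X, EMD.IsSubgradient X (fun y => F y z) x (G x z))
    -- Lipschitz continuity, for stationary-almost every point and for the samples
    (L : ℝ) (hL : 0 ≤ L)
    (hLip_stat : ∀ᵐ z ∂stat, EMD.LipschitzOver X L (fun x => F x z))
    (hLip_sample : ∀ t, 1 ≤ t → ∀ᵐ ω ∂P, EMD.LipschitzOver X L (fun x => F x (ξ t ω)))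
    (hG_sample : ∀ t, 1 ≤ t → ∀ᵐ ω ∂P, ∀ x ∈ X, ‖G x (ξ t ω)‖ ≤ L)
    -- the prox-function and the radius
    (ψ : E → ℝ) (hψ : EMD.IsProx ψ X)
    (R : ℝ) (hR : 0 ≤ R) (hrad : ∀ x ∈ X, ∀ y ∈ X, EMD.bregman ψ X x y ≤ (1 / 2) * R ^ 2)
    -- the algorithm
    (α : ℕ → ℝ) (hα : ∀ t, 1 ≤ t → 0 < α t) (hα_anti : AntitoneOn α (Set.Ici 1))
    (x₁ : E) (x : ℕ → Ω → E) (hx : EMD.IsErgodicMirrorDescent X ψ G α ξ x₁ x)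
    -- stochastically uniform mixing
    (tmix : ℝ → ℝ) (Γ : ℝ) (hmix : EMD.StochasticallyUniformMixing P ξ stat tmix Γ)
    (T : ℕ) (hT : 1 ≤ T) (δ : ℝ) (hδ : δ ∈ Set.Ioo (0 : ℝ) 1) :
    1 - δ ≤ P.real {ω | ∀ xstar ∈ X,
      ((EMD.objective F stat (EMD.average x T ω) - EMD.objective F stat xstar : ℝ) : EReal) ≤
        ⨅ ε : {ε : ℝ // 0 < ε},
          ((EMD.rateBound R L α T ε δ (EMD.tau tmix Γ T ε δ) : ℝ) : EReal)} := by
  -- The gap to a minimizer dominates the gap to every other comparison point, so one u suffices.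
  obtain ⟨u, hu, humin⟩ := hXc.exists_isMinOn ⟨x₁, hx.init_mem⟩
    ((EMD.lipschitzOver_objective hFint hLip_stat).continuousOn hL)
  have hprob := EMD.prob_iInf_lt_le (P := P) (ι := {ε : ℝ // 0 < ε})
    (b := fun ε => EMD.rateBound R L α T ε δ (EMD.tau tmix Γ T ε δ))
    (Y := fun ω => EMD.objective F stat (EMD.average x T ω) - EMD.objective F stat u)
    hδ.1.le fun ε => EMD.prob_rateBound_lt_gap_le hξ hXconv hFmeas hFconv hFint hGmeas hG hL
      hLip_stat hLip_sample hG_sample hψ hR hrad hα hα_anti hx hmix hT hδ ε.2 hu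
  -- Subadditivity over a cover of Ω needs no measurability of the events.
  have hcover := measureReal_union_le (μ := P)
    {ω | ∀ xstar ∈ X,
      ((EMD.objective F stat (EMD.average x T ω) - EMD.objective F stat xstar : ℝ) : EReal) ≤
        ⨅ ε : {ε : ℝ // 0 < ε},
          ((EMD.rateBound R L α T ε δ (EMD.tau tmix Γ T ε δ) : ℝ) : EReal)}
    {ω | (⨅ ε : {ε : ℝ // 0 < ε},
          ((EMD.rateBound R L α T ε δ (EMD.tau tmix Γ T ε δ) : ℝ) : EReal)) <
      ((EMD.objective F stat (EMD.average x T ω) - EMD.objective F stat u : ℝ) : EReal)}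
  have huniv : ∀ {A B : Set Ω}, Bᶜ ⊆ A → A ∪ B = Set.univ := fun {A B} hAB =>
    Set.eq_univ_of_forall fun ω => or_iff_not_imp_right.2 fun hω => hAB hω
  rw [huniv, probReal_univ] at hcover
  · linarith
  · intro ω hω xstar hxstar
    refine le_trans (EReal.coe_le_coe_iff.2 ?_) (not_lt.1 hω)
    have : EMD.objective F stat u ≤ EMD.objective F stat xstar := humin hxstar
    linarith
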